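/- Let $\theta\in\mathbb R$ with $\sin\theta\neq 0$, and put $a=\tfrac12\cot\theta$, $b=\csc\theta$, $c(\theta)=\sqrt{(1-i\cot\theta)/2\pi}$, $\Delta=2\pi/|b|=2\pi|\sin\theta|$, $\lambda_\theta(t)=e^{iat^2}$, $K_\theta(t,\xi)=c(\theta)e^{ia(t^2+\xi^2)-ibt\xi}$. For $\phi\in L^2(\mathbb R)$ write $\vec\phi=\lambda_\theta\phi$ and let $\hat\phi_\theta(\xi)=\int_{\mathbb R}\phi(t)K_\theta(t,\xi)\,dt$ be its fractional Fourier transform (extended from $L^1\cap L^2$ to $L^2$). Put $$C_{\phi,\theta}(t)=\sum_{n\in\mathbb Z}|\vec\phi(t-n)|^2,\quad G_{\phi,\theta}(\xi)=\sum_{n\in\mathbb Z}|\hat\phi_\theta(\xi+n\Delta)|^2,\quad Z_{\phi,\theta}(t,\xi)=\sum_{n\in\mathbb Z}\vec\phi(t-n)\lambda_\theta(n)\overline{K_\theta(n,\xi)},$$ where for fixed $t$ with $C_{\phi,\theta}(t)<\infty$ the last series converges in $L^2$ in $\xi$ on every bounded interval. Let $V_\theta(\phi)$ be the closed span in $L^2(\mathbb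 R)$ of the functions $c(\theta)\overline{\lambda_\theta(t)}\,\vec\phi(t-n)$, $n\in\mathbb Z$. Assume that $\phi$ is defined everywhere on $\mathbb R$, that $C_{\phi,\theta}(t)<\infty$ for every $t\in\mathbb R$, and that there are constants $B\ge A>0$ with $A\le G_{\phi,\theta}(\xi)\le B$ for a.e. $\xi\in[0,\Delta]$. Then every $f\in V_\theta(\phi)$ can be written as $f=\sum_n \lambda_\theta(n)c(n)\,c(\theta)\overline{\lambda_\theta(\cdot)}\,\vec\phi(\cdot-n)$ in $L^2(\mathbb R)$ with a unique $(c(n))\in\ell^2(\mathbb Z)$, and $f(t)$, for any $t\in\mathbb R$, denotes the sum of this series at $t$; in this way $V_\theta(\phi)$ is a reproducing kernel Hilbert space. **Theorem.** Let $0\le\sigma<1$ and let $E\subset\mathbb R$ be any interval of length $\Delta$. The following are equivalent. (a) There is a frame $\{S_n:n\in\mathbb Z\}$ of $V_\theta(\phi)$ such that $f(t)=\sum_{n\in\mathbb Z}f(\sigma+n)S_n(t)$ for all $f\in V_\theta(\phi)$. (b) There is a Riesz basis $\{S_n:n\in\mathbb Z\}$ of $V_\theta(\phi)$ such that $f(t)=\sum_{n\in\mathbb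 Z}f(\sigma+n)S_n(t)$ for all $f\in V_\theta(\phi)$. (c) There are constants $\beta\ge\alpha>0$ such that $\alpha\le|Z_{\phi,\theta}(\sigma,\xi)|\le\beta$ for a.e. $\xi\in[0,\Delta]$. (d) There are constants $\beta\ge\alpha>0$ such that $\alpha\le|Z_{\phi,\theta}(\sigma,\xi)|\le\beta$ for a.e. $\xi\in E$. Here the series in (a) and in (b) may be understood either as converging pointwise on $\mathbb R$, or as converging in $L^2(\mathbb R)$ and uniformly on every subset of $\mathbb R$ on which $C_{\phi,\theta}$ is bounded; the equivalence holds with either reading (all sums over $\mathbb Z$ are unconditional). -/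

import Mathlib

open MeasureTheory Filter Topology FourierTransform
open scoped ENNReal NNReal ComplexConjugate

noncomputable section

namespace FracSampling

/-! ### Frames and Riesz bases indexed by `ℤ` -/

section Hilbert

variable {H : Type*} [NormedAddCommGroup H] [InnerProductSpace ℂ H]

/-- `x` is a frame of the Hilbert space `H`. -/
def IsFrame (x : ℤ → H) : Prop :=
  ∃ A B : ℝ, 0 < A ∧ A ≤ B ∧ ∀ f : H,
    Summable (fun n => ‖inner ℂ (x n) f‖ ^ 2) ∧
    A * ‖f‖ ^ 2 ≤ ∑' n, ‖inner ℂ (x n) f‖ ^ 2 ∧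
    ∑' n, ‖inner ℂ (x n) f‖ ^ 2 ≤ B * ‖f‖ ^ 2

/-- `x` is a Riesz basis of the Hilbert space `H`: it is complete in `H` and
`A ‖c‖² ≤ ‖∑ c(n) x(n)‖² ≤ B ‖c‖²` for all `c ∈ ℓ²(ℤ)`. -/
def IsRieszBasis (x : ℤ → H) : Prop :=
  (Submodule.span ℂ (Set.range x)).topologicalClosure = ⊤ ∧
  ∃ A B : ℝ, 0 < A ∧ A ≤ B ∧ ∀ c : lp (fun _ : ℤ => ℂ) 2,
    Summable (fun n => c n • x n) ∧
    A * ‖c‖ ^ 2 ≤ ‖∑' n, c n • x n‖ ^ 2 ∧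
    ‖∑' n, c n • x n‖ ^ 2 ≤ B * ‖c‖ ^ 2

end Hilbert

/-! ### The fractional Fourier transform, for `sin θ ≠ 0` -/

/-- `a(θ) = cot θ / 2`. -/
def coefA (θ : ℝ) : ℝ := Real.cot θ / 2

/-- `b(θ) = csc θ`. -/
def coefB (θ : ℝ) : ℝ := (Real.sin θ)⁻¹

/-- `c(θ) = √((1 - i cot θ) / 2π)`, principal branch. -/
def coefC (θ : ℝ) : ℂ := ((1 - Complex.I * (Real.cot θ : ℂ)) / (2 * (Real.pi : ℂ))) ^ (1 / 2 : ℂ)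

/-- `Δ = 2π / |b| = 2π |sin θ|`. -/
def period (θ : ℝ) : ℝ := 2 * Real.pi / |coefB θ|

/-- The modulation function `λ_θ(t) = exp(i a t²)`. -/
def chirp (θ t : ℝ) : ℂ := Complex.exp (((coefA θ * t ^ 2 : ℝ) : ℂ) * Complex.I)

/-- The kernel `K_θ(t, ξ) = c(θ) exp(i a (t² + ξ²) - i b t ξ)`. -/
def kernel (θ t ξ : ℝ) : ℂ :=
  coefC θ * Complex.exp (((coefA θ * (t ^ 2 + ξ ^ 2) - coefB θ * t * ξ : ℝ) : ℂ) * Complex.I)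

/-- The chirp-modulated version `λ_θ φ` of `φ`. -/
def modulate (θ : ℝ) (φ : ℝ → ℂ) (t : ℝ) : ℂ := chirp θ t * φ t

/-- `η_θ(t) = c(θ) conj λ_θ(t)`. -/
def eta (θ t : ℝ) : ℂ := coefC θ * conj (chirp θ t)

theorem norm_chirp (θ t : ℝ) : ‖chirp θ t‖ = 1 :=
  Complex.norm_exp_ofReal_mul_I _

theorem continuous_chirp (θ : ℝ) : Continuous (chirp θ) := by
  unfold chirp; fun_prop

theorem memLp_modulate (θ : ℝ) {φ : ℝ → ℂ} (hφ : MemLp φ 2 volume) :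
    MemLp (modulate θ φ) 2 volume :=
  hφ.of_le ((continuous_chirp θ).aestronglyMeasurable.mul hφ.1)
    (Eventually.of_forall fun t => by simp [modulate, norm_chirp])

theorem memLp_atom (θ : ℝ) {φ : ℝ → ℂ} (hφ : MemLp φ 2 volume) (n : ℤ) :
    MemLp (fun t : ℝ => eta θ t * modulate θ φ (t - n)) 2 volume := by
  have h : MemLp (fun t : ℝ => modulate θ φ (t - n)) 2 volume :=
    (memLp_modulate θ hφ).comp_measurePreserving (measurePreserving_sub_right volume (n : ℝ))
  have hc : Continuous (eta θ) :=
    continuous_const.mul (Complex.continuous_conj.comp (continuous_chirp θ))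
  exact h.of_le_mul (c := ‖coefC θ‖) (hc.aestronglyMeasurable.mul h.1)
    (Eventually.of_forall fun t => by simp [eta, norm_chirp])

/-- The fractional Fourier transform of `φ ∈ L²(ℝ)`, determined up to a null set.  Since
`K_θ(t, ξ) = c(θ) λ_θ(ξ) λ_θ(t) exp(-2πi t (bξ/2π))`, the integral `∫ φ(t) K_θ(t, ξ) dt`, extended
from `L¹ ∩ L²` to `L²`, is `c(θ) λ_θ(ξ)` times the `L²` Fourier transform of `λ_θ φ` at `bξ/2π`
(Mathlib's Fourier transform has the kernel `exp(-2πi t w)`). -/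
def frft (θ : ℝ) {φ : ℝ → ℂ} (hφ : MemLp φ 2 volume) (ξ : ℝ) : ℂ :=
  coefC θ * chirp θ ξ *
    (𝓕 ((memLp_modulate θ hφ).toLp (modulate θ φ)) : Lp ℂ 2 (volume : Measure ℝ))
      (coefB θ * ξ / (2 * Real.pi))

/-- `C_{φ,θ}(t) = ∑ |(λ_θ φ)(t - n)|²`, with values in `[0, ∞]`. -/
def sumC (θ : ℝ) (φ : ℝ → ℂ) (t : ℝ) : ℝ≥0∞ := ∑' n : ℤ, ‖modulate θ φ (t - n)‖ₑ ^ 2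

/-- `G_{φ,θ}(ξ) = ∑ |φ̂_θ(ξ + nΔ)|²`, with values in `[0, ∞]`. -/
def sumG (θ : ℝ) {φ : ℝ → ℂ} (hφ : MemLp φ 2 volume) (ξ : ℝ) : ℝ≥0∞ :=
  ∑' n : ℤ, ‖frft θ hφ (ξ + n * period θ)‖ₑ ^ 2

/-! ### The fractional Zak transform -/

/-- The general term `(λ_θ φ)(t - n) λ_θ(n) conj K_θ(n, ξ)` of the fractional Zak series. -/
def zakTerm (θ : ℝ) (φ : ℝ → ℂ) (t : ℝ) (n : ℤ) (ξ : ℝ) : ℂ :=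
  modulate θ φ (t - n) * chirp θ n * conj (kernel θ n ξ)

/-- For fixed `t`, the fractional Zak series converges to `Z` in `L²` on every bounded interval.
This determines `Z` up to a null set. -/
def IsZak (θ : ℝ) (φ : ℝ → ℂ) (t : ℝ) (Z : ℝ → ℂ) : Prop :=
  AEStronglyMeasurable Z volume ∧ ∀ x y : ℝ,
    Tendsto (fun s : Finset ℤ =>
        eLpNorm (fun ξ => (∑ n ∈ s, zakTerm θ φ t n ξ) - Z ξ) 2 (volume.restrict (Set.Icc x y)))
      atTop (𝓝 0)

open Classical in
/-- The fractional Zak transform `Z_{φ,θ}(t, ·)`, the sum of its series in `L²_loc(ℝ)`. -/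
def zak (θ : ℝ) (φ : ℝ → ℂ) (t : ℝ) : ℝ → ℂ :=
  if h : ∃ Z, IsZak θ φ t Z then h.choose else 0

/-! ### The chirp-modulated shift-invariant space -/

/-- The function `η_θ(t) (λ_θ φ)(t - n)` as an element of `L²(ℝ)`. -/
def atom (θ : ℝ) {φ : ℝ → ℂ} (hφ : MemLp φ 2 volume) (n : ℤ) : Lp ℂ 2 (volume : Measure ℝ) :=
  (memLp_atom θ hφ n).toLp _

/-- `V_θ(φ)`, the closed span in `L²(ℝ)` of the functions `η_θ(t) (λ_θ φ)(t - n)`, `n ∈ ℤ`. -/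
def chirpSpace (θ : ℝ) {φ : ℝ → ℂ} (hφ : MemLp φ 2 volume) :
    Submodule ℂ (Lp ℂ 2 (volume : Measure ℝ)) :=
  (Submodule.span ℂ (Set.range (atom θ hφ))).topologicalClosure

/-- The fractional semi-discrete convolution, as a pointwise sum:
`(c ∗_θ φ)(t) = c(θ) conj λ_θ(t) ∑ λ_θ(n) c(n) (λ_θ φ)(t - n)`. -/
def fracConv (θ : ℝ) (φ : ℝ → ℂ) (c : ℤ → ℂ) (t : ℝ) : ℂ :=
  eta θ t * ∑' n : ℤ, chirp θ n * c n * modulate θ φ (t - n)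

/-- `f = c ∗_θ φ` with convergence in `L²(ℝ)`. -/
def IsFracConv (θ : ℝ) {φ : ℝ → ℂ} (hφ : MemLp φ 2 volume) (c : ℤ → ℂ)
    (f : Lp ℂ 2 (volume : Measure ℝ)) : Prop :=
  HasSum (fun n : ℤ => (chirp θ n * c n) • atom θ hφ n) f

open Classical in
/-- The value `f(t)` of an element `f` of the reproducing kernel Hilbert space `V_θ(φ)`: if
`f = c ∗_θ φ` in `L²(ℝ)` with `c ∈ ℓ²(ℤ)`, then `f(t)` is the pointwise sum `(c ∗_θ φ)(t)`.
(When the functions `η_θ(t) (λ_θ φ)(t - n)` form a Riesz basis of `V_θ(φ)`, such a `c` exists and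
is unique.) -/
def value (θ : ℝ) {φ : ℝ → ℂ} (hφ : MemLp φ 2 volume) (f : chirpSpace θ hφ) (t : ℝ) : ℂ :=
  if h : ∃ c : lp (fun _ : ℤ => ℂ) 2, IsFracConv θ hφ c f then fracConv θ φ h.choose t else 0

/-! ### Sampling expansions -/

/-- `f(t) = ∑ f(σ + n) S_n(t)` for all `f ∈ V_θ(φ)`, pointwise on `ℝ`. -/
def ExpandsPointwise (θ : ℝ) {φ : ℝ → ℂ} (hφ : MemLp φ 2 volume) (σ : ℝ)
    (S : ℤ → chirpSpace θ hφ) : Prop :=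
  ∀ (f : chirpSpace θ hφ) (t : ℝ),
    HasSum (fun n : ℤ => value θ hφ f (σ + n) * value θ hφ (S n) t) (value θ hφ f t)

/-- `f = ∑ f(σ + n) S_n` for all `f ∈ V_θ(φ)`, with convergence in `L²(ℝ)` and uniform convergence
on every subset of `ℝ` on which `C_{φ,θ}` is bounded (in particular at every point at which
`C_{φ,θ}` is finite). -/
def ExpandsStrongly (θ : ℝ) {φ : ℝ → ℂ} (hφ : MemLp φ 2 volume) (σ : ℝ)
    (S : ℤ → chirpSpace θ hφ) : Prop :=
  ∀ f : chirpSpace θ hφ,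
    HasSum (fun n : ℤ => value θ hφ f (σ + n) • S n) f ∧
    ∀ X : Set ℝ, (∃ M : ℝ≥0, ∀ t ∈ X, sumC θ φ t ≤ M) →
      TendstoUniformlyOn
        (fun (s : Finset ℤ) (t : ℝ) => ∑ n ∈ s, value θ hφ f (σ + n) * value θ hφ (S n) t)
        (value θ hφ f) atTop X

end FracSampling

end

/-! Everything is transported to L² of the circle of length Δ. By Plancherel and periodization, the
norm of a finite combination of the functions η_θ(t)(λ_θφ)(t - n) is the G-weighted norm of a
trigonometric polynomial, so the bounds on G make these functions a Riesz basis of V_θ(φ)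
(`isRieszBasis_spaceAtom`). Thus f ∈ V_θ(φ) corresponds to the F in L² of the circle with the same
coefficients against exp(-ibnξ).

Let Φ(ξ) = ∑ (λ_θφ)(σ+n) exp(-ibnξ). Sampling is a convolution of coefficients: whenever ΦF is in
L², the f(σ+m) are its coefficients up to factors of modulus |c(θ)| (`value_samples`). Moreover
|Z(σ,·)| = |c(θ)||Φ| a.e. (`norm_zak_ae`), so both Zak conditions say that |Φ| is bounded above and
away from zero on the circle.

If it is, multiplication by Φ is invertible, sampling is an isomorphism of V_θ(φ) onto ℓ², and the
preimages of the unit vectors form the required Riesz basis. Conversely, Φ is a priori only in L²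
and multiplication by it may be unbounded. The synthesis operator of a sampling frame then provides
a bounded left inverse B of F ↦ ΦF on its natural domain. Boundedness of B keeps |Φ| away from zero,
so B is multiplication by 1/Φ; the lower frame bound makes the adjoint of B bounded below, which
bounds |Φ| above (`exists_bounds_of_left_inverse`). -/

noncomputable section

namespace FracSampling

/-! ### Synthesis and analysis operators of Riesz bases and frames -/

section Hilbert

variable {H : Type*} [NormedAddCommGroup H] [InnerProductSpace ℂ H] {x : ℤ → H}

theorem hasSum_norm_sq_lp (c : lp (fun _ : ℤ => ℂ) 2) :
    HasSum (fun n => ‖c n‖ ^ 2) (‖c‖ ^ 2) := by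
  have h := lp.hasSum_norm (p := 2) (by norm_num) c
  simpa using h

theorem hasSum_smul_single (c : lp (fun _ : ℤ => ℂ) 2) :
    HasSum (fun n => c n • lp.single (E := fun _ : ℤ => ℂ) 2 n (1 : ℂ)) c := by
  have h := lp.hasSum_single (E := fun _ : ℤ => ℂ) (p := 2) (by norm_num) c
  refine h.congr_fun fun n => ?_
  rw [← lp.single_smul]
  simp

theorem summable_smul_of_finite_bound [CompleteSpace H] {B : ℝ}
    (h : ∀ (s : Finset ℤ) (c : ℤ → ℂ), ‖∑ n ∈ s, c n • x n‖ ^ 2 ≤ B * ∑ n ∈ s, ‖c n‖ ^ 2)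
    (c : lp (fun _ : ℤ => ℂ) 2) : Summable (fun n => c n • x n) := by
  rw [summable_iff_vanishing_norm]
  intro ε hε
  have hs := (hasSum_norm_sq_lp c).summable
  rw [summable_iff_vanishing_norm] at hs
  -- No sign is assumed for B; |B| + 1 is positive and dominates it.
  obtain ⟨s, hs⟩ := hs (ε ^ 2 / (|B| + 1)) (by positivity)
  refine ⟨s, fun t ht => ?_⟩
  have h1 := hs t ht
  have h0 : 0 ≤ ∑ n ∈ t, ‖c n‖ ^ 2 := by positivity
  rw [Real.norm_of_nonneg h0, lt_div_iff₀ (by positivity)] at h1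
  have h2 := h t c
  have h3 : B * ∑ n ∈ t, ‖c n‖ ^ 2 ≤ (|B| + 1) * ∑ n ∈ t, ‖c n‖ ^ 2 :=
    mul_le_mul_of_nonneg_right ((le_abs_self B).trans (by linarith)) h0
  exact lt_of_pow_lt_pow_left₀ 2 hε.le (by linarith)

/-- Two-sided bounds for finite combinations of a complete system yield a Riesz basis. -/
theorem IsRieszBasis.of_finite_bounds [CompleteSpace H]
    (hd : (Submodule.span ℂ (Set.range x)).topologicalClosure = ⊤)
    {A B : ℝ} (hA : 0 < A) (hAB : A ≤ B)
    (h : ∀ (s : Finset ℤ) (c : ℤ → ℂ), A * ∑ n ∈ s, ‖c n‖ ^ 2 ≤ ‖∑ n ∈ s, c n • x n‖ ^ 2 ∧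
      ‖∑ n ∈ s, c n • x n‖ ^ 2 ≤ B * ∑ n ∈ s, ‖c n‖ ^ 2) : IsRieszBasis x := by
  refine ⟨hd, A, B, hA, hAB, fun c => ?_⟩
  have hs := summable_smul_of_finite_bound (fun s c => (h s c).2) c
  have h1 : Tendsto (fun s : Finset ℤ => ‖∑ n ∈ s, c n • x n‖ ^ 2) atTop
      (𝓝 (‖∑' n, c n • x n‖ ^ 2)) := (hs.hasSum.norm).pow 2
  have h2 : Tendsto (fun s : Finset ℤ => ∑ n ∈ s, ‖c n‖ ^ 2) atTop (𝓝 (‖c‖ ^ 2)) :=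
    hasSum_norm_sq_lp c
  exact ⟨hs, le_of_tendsto_of_tendsto' (h2.const_mul A) h1 fun s => (h s c).1,
    le_of_tendsto_of_tendsto' h1 (h2.const_mul B) fun s => (h s c).2⟩

theorem synthesis_single {F : Type*} [FunLike F (lp (fun _ : ℤ => ℂ) 2) H] {e : F}
    (he : ∀ c, HasSum (fun n => c n • x n) (e c)) (n : ℤ) : e (lp.single 2 n 1) = x n := by
  refine (he _).unique ?_
  convert hasSum_single n ?_ using 1
  · simp
  · intro m hm
    simp [lp.single_apply, hm]

/-- The synthesis operator of a Riesz basis is an isomorphism. -/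
theorem IsRieszBasis.exists_equiv [CompleteSpace H] (hx : IsRieszBasis x) :
    ∃ e : lp (fun _ : ℤ => ℂ) 2 ≃L[ℂ] H, ∀ c, HasSum (fun n => c n • x n) (e c) := by
  obtain ⟨hd, A, B, hA, hAB, h⟩ := hx
  let T₀ : lp (fun _ : ℤ => ℂ) 2 →ₗ[ℂ] H :=
    { toFun := fun c => ∑' n, c n • x n
      map_add' := fun c d => by
        rw [← (h c).1.tsum_add (h d).1]
        simp [add_smul]
      map_smul' := fun a c => by
        rw [RingHom.id_apply, ← (h c).1.tsum_const_smul]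
        simp [mul_smul] }
  have hB : 0 ≤ B := hA.le.trans hAB
  let T : lp (fun _ : ℤ => ℂ) 2 →L[ℂ] H := T₀.mkContinuous (√B) fun c => by
    have h1 := (h c).2.2
    refine le_of_sq_le_sq ?_ (by positivity)
    rw [mul_pow, Real.sq_sqrt hB]
    exact h1
  have hT : ∀ c, HasSum (fun n => c n • x n) (T c) := fun c => (h c).1.hasSum
  -- The lower bound makes the range closed; since it contains every `x n`, completeness of the
  -- system makes it everything.
  have hanti : AntilipschitzWith (Real.toNNReal (√A)⁻¹) T := by
    refine ContinuousLinearMap.antilipschitz_of_bound _ fun c => ?_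
    have h1 : A * ‖c‖ ^ 2 ≤ ‖T c‖ ^ 2 := (h c).2.1
    rw [Real.coe_toNNReal _ (by positivity), ← div_eq_inv_mul, le_div_iff₀ (by positivity)]
    refine le_of_sq_le_sq ?_ (by positivity)
    rw [mul_pow, Real.sq_sqrt hA.le]
    linarith
  have hclosed : IsClosed (Set.range T) := hanti.isClosed_range T.uniformContinuous
  have hsurj : T.range = ⊤ := by
    rw [eq_top_iff, ← hd]
    refine Submodule.topologicalClosure_minimal _ ?_ hclosed
    rw [Submodule.span_le]
    rintro _ ⟨n, rfl⟩
    exact ⟨lp.single 2 n 1, synthesis_single hT n⟩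
  exact ⟨ContinuousLinearEquiv.ofBijective T (LinearMap.ker_eq_bot.2 hanti.injective) hsurj, hT⟩

theorem IsRieszBasis.of_equiv (e : lp (fun _ : ℤ => ℂ) 2 ≃L[ℂ] H)
    (he : ∀ c, HasSum (fun n => c n • x n) (e c)) : IsRieszBasis x := by
  -- Adding 1 to both operator norms puts the lower constant below 1 and the upper one above 1, so
  -- they are ordered.
  refine ⟨?_, ((‖(e.symm : H →L[ℂ] lp (fun _ : ℤ => ℂ) 2)‖ + 1) ^ 2)⁻¹,
    (‖(e : lp (fun _ : ℤ => ℂ) 2 →L[ℂ] H)‖ + 1) ^ 2, by positivity, ?_, fun c => ?_⟩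
  · rw [eq_top_iff]
    intro f _
    have h := he (e.symm f)
    rw [e.apply_symm_apply] at h
    refine mem_closure_of_tendsto h (Eventually.of_forall fun s => ?_)
    exact Submodule.sum_mem _ fun n _ =>
      Submodule.smul_mem _ _ (Submodule.subset_span (Set.mem_range_self n))
  · refine (inv_le_one_of_one_le₀ (one_le_pow₀ ?_)).trans (one_le_pow₀ ?_) <;>
      linarith [norm_nonneg (e.symm : H →L[ℂ] lp (fun _ : ℤ => ℂ) 2),
        norm_nonneg (e : lp (fun _ : ℤ => ℂ) 2 →L[ℂ] H)]
  · rw [(he c).tsum_eq]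
    refine ⟨(he c).summable, ?_, ?_⟩
    · rw [inv_mul_le_iff₀ (by positivity), ← mul_pow]
      gcongr
      have h1 := (e.symm : H →L[ℂ] lp (fun _ : ℤ => ℂ) 2).le_opNorm (e c)
      simp only [ContinuousLinearEquiv.coe_coe, e.symm_apply_apply] at h1
      nlinarith [norm_nonneg (e c)]
    · rw [← mul_pow]
      gcongr
      have h1 := (e : lp (fun _ : ℤ => ℂ) 2 →L[ℂ] H).le_opNorm c
      simp only [ContinuousLinearEquiv.coe_coe] at h1
      nlinarith [norm_nonneg c]

/-- The adjoint of the inverse is a bounded left inverse of the adjoint. -/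
theorem exists_adjoint_lower_bound {K : Type*} [NormedAddCommGroup K] [InnerProductSpace ℂ K]
    [CompleteSpace H] [CompleteSpace K] (e : H ≃L[ℂ] K) :
    ∃ a : ℝ, 0 < a ∧ ∀ y, a * ‖y‖ ≤ ‖(e : H →L[ℂ] K).adjoint y‖ := by
  let R : K →L[ℂ] H := e.symm
  refine ⟨(‖R‖ + 1)⁻¹, by positivity, fun y => ?_⟩
  rw [inv_mul_le_iff₀ (by positivity)]
  have h1 := R.adjoint.le_opNorm ((e : H →L[ℂ] K).adjoint y)
  have h2 : R.adjoint ((e : H →L[ℂ] K).adjoint y) = y := by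
    rw [← ContinuousLinearMap.comp_apply, ← ContinuousLinearMap.adjoint_comp]
    have : (e : H →L[ℂ] K).comp R = ContinuousLinearMap.id ℂ K := by ext; simp [R]
    rw [this, ContinuousLinearMap.adjoint_id]
    rfl
  rw [h2, LinearIsometryEquiv.norm_map] at h1
  nlinarith [norm_nonneg ((e : H →L[ℂ] K).adjoint y)]

/-- The analysis map f ↦ (⟨x n, f⟩) is the adjoint of the synthesis isomorphism, hence bounded and
bounded below. -/
theorem IsRieszBasis.isFrame [CompleteSpace H] (hx : IsRieszBasis x) : IsFrame x := by
  obtain ⟨e, he⟩ := hx.exists_equiv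
  let T : lp (fun _ : ℤ => ℂ) 2 →L[ℂ] H := e
  have hin : ∀ f n, inner ℂ (x n) f = T.adjoint f n := fun f n => by
    rw [← synthesis_single he n]
    change inner ℂ (T _) f = _
    rw [← ContinuousLinearMap.adjoint_inner_right, lp.inner_single_left]
    simp
  obtain ⟨a, ha, hlow⟩ := exists_adjoint_lower_bound e
  refine ⟨a ^ 2, max (a ^ 2) (‖T‖ ^ 2), by positivity, le_max_left _ _, fun f => ?_⟩
  have hs := hasSum_norm_sq_lp (T.adjoint f)
  simp only [hin]
  rw [hs.tsum_eq]
  refine ⟨hs.summable, ?_, ?_⟩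
  · rw [← mul_pow]
    exact pow_le_pow_left₀ (by positivity) (hlow f) 2
  · refine le_trans ?_ (mul_le_mul_of_nonneg_right (le_max_right _ _) (by positivity))
    rw [← mul_pow]
    have h1 := T.adjoint.le_opNorm f
    rw [LinearIsometryEquiv.norm_map] at h1
    exact pow_le_pow_left₀ (norm_nonneg _) h1 2

/-- The analysis operator of a frame is bounded and bounded below; its adjoint is the synthesis
operator. -/
theorem IsFrame.exists_analysis [CompleteSpace H] (hx : IsFrame x) :
    ∃ (L : H →L[ℂ] lp (fun _ : ℤ => ℂ) 2) (a : ℝ), 0 < a ∧ (∀ f, a * ‖f‖ ≤ ‖L f‖) ∧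
      ∀ c, HasSum (fun n => c n • x n) (L.adjoint c) := by
  obtain ⟨A, B, hA, hAB, h⟩ := hx
  have hmem : ∀ f, Memℓp (fun n => inner ℂ (x n) f) 2 := fun f => by
    refine memℓp_gen ?_
    simpa using (h f).1
  let L₀ : H →ₗ[ℂ] lp (fun _ : ℤ => ℂ) 2 :=
    { toFun := fun f => ⟨fun n => inner ℂ (x n) f, hmem f⟩
      map_add' := fun f g => lp.ext (funext fun n => inner_add_right _ _ _)
      map_smul' := fun a f => lp.ext (funext fun n => inner_smul_right _ _ _) }
  have hL₀ : ∀ f, ‖L₀ f‖ ^ 2 = ∑' n, ‖inner ℂ (x n) f‖ ^ 2 := fun f =>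
    (hasSum_norm_sq_lp (L₀ f)).tsum_eq.symm
  have hB : 0 ≤ B := hA.le.trans hAB
  let L : H →L[ℂ] lp (fun _ : ℤ => ℂ) 2 := L₀.mkContinuous (√B) fun f => by
    refine le_of_sq_le_sq ?_ (by positivity)
    rw [mul_pow, Real.sq_sqrt hB, hL₀]
    exact (h f).2.2
  have hL : ∀ f n, L f n = inner ℂ (x n) f := fun f n => rfl
  refine ⟨L, √A, Real.sqrt_pos.2 hA, fun f => ?_, fun c => ?_⟩
  · refine le_of_sq_le_sq ?_ (by positivity)
    rw [mul_pow, Real.sq_sqrt hA.le]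
    exact ((h f).2.1).trans_eq (hL₀ f).symm
  · have h1 := (hasSum_smul_single c).mapL L.adjoint
    refine h1.congr_fun fun n => ?_
    rw [map_smul]
    congr 1
    refine ext_inner_right ℂ fun f => ?_
    rw [ContinuousLinearMap.adjoint_inner_left, lp.inner_single_left, hL]
    simp

end Hilbert

/-! ### Multiplication operators on L² -/

section Multiplication

variable {α : Type*} [MeasurableSpace α] {μ : Measure α} {g : α → ℂ}

/-- Hölder's inequality with exponents ∞, 2, 2. -/
theorem exists_mul_clm (hg : AEStronglyMeasurable g μ) {β : ℝ} (hβ : ∀ᵐ x ∂μ, ‖g x‖ ≤ β) :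
    ∃ M : Lp ℂ 2 μ →L[ℂ] Lp ℂ 2 μ, ∀ F, M F =ᵐ[μ] fun x => g x * F x := by
  have hm : MemLp g ∞ μ := memLp_top_of_bound hg β hβ
  refine ⟨(ContinuousLinearMap.mul ℂ ℂ).holderL μ ∞ 2 2 (hm.toLp g), fun F => ?_⟩
  rw [ContinuousLinearMap.holderL_apply_apply]
  filter_upwards [(ContinuousLinearMap.mul ℂ ℂ).coeFn_holder (r := 2) (hm.toLp g) F,
    hm.coeFn_toLp] with x h1 h2
  rw [h1, h2]
  rfl

/-- Multiplication by a function bounded above and away from zero is an isomorphism of `L²`. -/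
theorem exists_mul_equiv (hg : AEStronglyMeasurable g μ) {a b : ℝ} (ha : 0 < a)
    (hab : ∀ᵐ x ∂μ, a ≤ ‖g x‖ ∧ ‖g x‖ ≤ b) :
    ∃ M : Lp ℂ 2 μ ≃L[ℂ] Lp ℂ 2 μ, ∀ F, M F =ᵐ[μ] fun x => g x * F x := by
  obtain ⟨M, hM⟩ := exists_mul_clm hg (hab.mono fun x h => h.2)
  obtain ⟨N, hN⟩ := exists_mul_clm (g := fun x => (g x)⁻¹) (μ := μ) (β := a⁻¹)
    hg.aemeasurable.inv.aestronglyMeasurable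
    (hab.mono fun x h => by rw [norm_inv]; exact inv_anti₀ ha h.1)
  have h0 : ∀ᵐ x ∂μ, g x ≠ 0 := hab.mono fun x h => norm_pos_iff.1 (ha.trans_le h.1)
  refine ⟨ContinuousLinearEquiv.equivOfInverse M N (fun F => ?_) (fun F => ?_), hM⟩
  · refine Lp.ext ?_
    filter_upwards [hM F, hN (M F), h0] with x h1 h2 h3
    rw [h2, h1, inv_mul_cancel_left₀ h3]
  · refine Lp.ext ?_
    filter_upwards [hN F, hM (N F), h0] with x h1 h2 h3
    rw [h2, h1, mul_inv_cancel_left₀ h3]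

theorem measure_eq_zero_of_indicatorConstLp_eq_zero {s : Set α} (hs : MeasurableSet s)
    (hμs : μ s ≠ ∞) (h : indicatorConstLp 2 hs hμs (1 : ℂ) = 0) : μ s = 0 := by
  have h1 := indicatorConstLp_coeFn (p := 2) (hs := hs) (hμs := hμs) (c := (1 : ℂ))
  rw [h] at h1
  have h2 : ∀ᵐ x ∂μ, x ∉ s := by
    filter_upwards [h1, Lp.coeFn_zero ℂ 2 μ] with x h3 h4 hx
    rw [h4, Set.indicator_of_mem hx] at h3
    simp at h3
  simpa [ae_iff] using h2

/-- If `F ↦ g F` has a bounded left inverse on its natural domain, then `g` is bounded away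
from zero. -/
theorem exists_lower_bound_of_left_inverse [IsFiniteMeasure μ] (hg : StronglyMeasurable g)
    (B : Lp ℂ 2 μ →L[ℂ] Lp ℂ 2 μ)
    (hB : ∀ F G : Lp ℂ 2 μ, (G =ᵐ[μ] fun x => g x * F x) → B G = F) :
    ∃ a : ℝ, 0 < a ∧ ∀ᵐ x ∂μ, a ≤ ‖g x‖ := by
  have ha : 0 < (‖B‖ + 1)⁻¹ := by positivity
  refine ⟨(‖B‖ + 1)⁻¹, ha, ?_⟩
  -- The indicator F of {|g| < a} satisfies ‖gF‖ ≤ a‖F‖, hence ‖F‖ ≤ ‖B‖a‖F‖. This value of a makes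
  -- ‖B‖a < 1 and forces F = 0.
  set a := (‖B‖ + 1)⁻¹ with ha_def
  let s : Set α := {x | ‖g x‖ < a}
  have hs : MeasurableSet s := measurableSet_lt hg.norm.measurable measurable_const
  have hbd : ∀ x, ‖s.indicator g x‖ ≤ a := fun x => by
    by_cases hx : x ∈ s
    · rw [Set.indicator_of_mem hx]; exact le_of_lt hx
    · rw [Set.indicator_of_notMem hx, norm_zero]; exact ha.le
  have hm : MemLp (s.indicator g) 2 μ :=
    MemLp.of_bound (hg.indicator hs).aestronglyMeasurable a (Eventually.of_forall hbd)
  let F := indicatorConstLp 2 hs (measure_ne_top μ s) (1 : ℂ)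
  have hF : F =ᵐ[μ] s.indicator fun _ => 1 := indicatorConstLp_coeFn
  have hBF : B (hm.toLp _) = F := hB F _ <| by
    filter_upwards [hm.coeFn_toLp, hF] with x h1 h2
    rw [h1, h2]
    by_cases hx : x ∈ s <;> simp [hx]
  have hle : ‖hm.toLp _‖ ≤ a * ‖F‖ := Lp.norm_le_mul_norm_of_ae_le_mul <| by
    filter_upwards [hm.coeFn_toLp, hF] with x h1 h2
    rw [h1, h2]
    by_cases hx : x ∈ s
    · simpa [hx] using le_of_lt hx
    · simp [hx]
  have h1 := B.le_opNorm (hm.toLp _)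
  rw [hBF] at h1
  have hF0 : F = 0 := by
    rw [← norm_le_zero_iff]
    have h2 : ‖F‖ ≤ ‖B‖ * (a * ‖F‖) :=
      h1.trans (mul_le_mul_of_nonneg_left hle (norm_nonneg _))
    have h3 : ‖B‖ * a = 1 - a := by rw [ha_def]; field_simp; ring
    nlinarith
  have h0 := measure_eq_zero_of_indicatorConstLp_eq_zero hs _ hF0
  have h0' : ∀ᵐ x ∂μ, x ∉ s := by simpa [ae_iff] using h0
  exact h0'.mono fun x hx => not_lt.1 hx

/-- If `F ↦ g F` has a bounded left inverse on its natural domain, with adjoint bounded below,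
then `g` is bounded above and away from zero. -/
theorem exists_bounds_of_left_inverse [IsFiniteMeasure μ] (hg : AEStronglyMeasurable g μ)
    (B : Lp ℂ 2 μ →L[ℂ] Lp ℂ 2 μ)
    (hB : ∀ F G : Lp ℂ 2 μ, (G =ᵐ[μ] fun x => g x * F x) → B G = F)
    {c : ℝ} (hc : 0 < c) (hlow : ∀ F, c * ‖F‖ ≤ ‖B.adjoint F‖) :
    ∃ a b : ℝ, 0 < a ∧ a ≤ b ∧ ∀ᵐ x ∂μ, a ≤ ‖g x‖ ∧ ‖g x‖ ≤ b := by
  -- A strongly measurable representative has measurable sublevel and superlevel sets.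
  wlog hgm : StronglyMeasurable g generalizing g
  · obtain ⟨a, b, ha, hab, h⟩ := this hg.stronglyMeasurable_mk.aestronglyMeasurable
      (fun F G h => hB F G <| by
        filter_upwards [h, hg.ae_eq_mk] with x h1 h2
        rw [h1, h2]) hg.stronglyMeasurable_mk
    refine ⟨a, b, ha, hab, ?_⟩
    filter_upwards [h, hg.ae_eq_mk] with x h1 h2
    rwa [h2]
  obtain ⟨a, ha, hlb⟩ := exists_lower_bound_of_left_inverse hgm B hB
  obtain ⟨M, hM⟩ := exists_mul_clm (g := fun x => (g x)⁻¹) (μ := μ) (β := a⁻¹)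
    hg.aemeasurable.inv.aestronglyMeasurable
    (hlb.mono fun x h => by rw [norm_inv]; exact inv_anti₀ ha h)
  -- With |g| ≥ a, every G is g times the L² function G/g, so the natural domain no longer restricts
  -- B.
  have hBM : ∀ G, B G = M G := fun G => hB _ _ <| by
    filter_upwards [hM G, hlb] with x h1 h2
    rw [h1, mul_inv_cancel_left₀ (norm_pos_iff.1 (ha.trans_le h2))]
  -- Where |g| > b, |1/g| is at most c/2, too small for the lower bound c on the adjoint of B unless
  -- that set is null. The maximum with a gives a ≤ b.
  let b := max a (2 / c)
  let s : Set α := {x | b < ‖g x‖}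
  have hs : MeasurableSet s := measurableSet_lt measurable_const hgm.norm.measurable
  have hb : 0 < b := ha.trans_le (le_max_left _ _)
  have hbd : ∀ x, ‖s.indicator (fun x => (g x)⁻¹) x‖ ≤ b⁻¹ := fun x => by
    by_cases hx : x ∈ s
    · rw [Set.indicator_of_mem hx, norm_inv]; exact inv_anti₀ hb (le_of_lt hx)
    · rw [Set.indicator_of_notMem hx, norm_zero]; positivity
  obtain ⟨N, hN⟩ := exists_mul_clm (g := s.indicator fun x => (g x)⁻¹) (μ := μ) (β := b⁻¹)
    (hg.aemeasurable.inv.indicator hs).aestronglyMeasurable (Eventually.of_forall hbd)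
  let F := indicatorConstLp 2 hs (measure_ne_top μ s) (1 : ℂ)
  have hF : F =ᵐ[μ] s.indicator fun _ => 1 := indicatorConstLp_coeFn
  -- F lives on s, so M may be replaced by its truncation N, of norm at most 1/b.
  have hin : ∀ G, inner ℂ F (M G) = inner ℂ F (N G) := fun G => by
    rw [L2.inner_def, L2.inner_def]
    refine integral_congr_ae ?_
    filter_upwards [hF, hM G, hN G] with x h1 h2 h3
    rw [h1, h2, h3]
    by_cases hx : x ∈ s <;> simp [hx]
  have hNle : ∀ G, ‖N G‖ ≤ b⁻¹ * ‖G‖ := fun G => Lp.norm_le_mul_norm_of_ae_le_mul <| by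
    filter_upwards [hN G] with x h1
    rw [h1, norm_mul]
    exact mul_le_mul_of_nonneg_right (hbd x) (norm_nonneg _)
  -- ‖B*F‖² = ⟨F, B B*F⟩ = ⟨F, N B*F⟩, then Cauchy–Schwarz.
  have h1 : ‖B.adjoint F‖ ^ 2 ≤ ‖F‖ * (b⁻¹ * ‖B.adjoint F‖) := by
    have h2 : inner ℂ (B.adjoint F) (B.adjoint F) = inner ℂ F (N (B.adjoint F)) := by
      rw [ContinuousLinearMap.adjoint_inner_left, hBM, hin]
    have h3 : ‖B.adjoint F‖ ^ 2 = ‖inner ℂ F (N (B.adjoint F))‖ := by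
      rw [← h2, inner_self_eq_norm_sq_to_K]; simp
    rw [h3]
    exact (norm_inner_le_norm _ _).trans (mul_le_mul_of_nonneg_left (hNle _) (norm_nonneg _))
  have hF0 : F = 0 := by
    rw [← norm_le_zero_iff]
    by_contra hpos
    rw [not_le] at hpos
    have h4 := hlow F
    have h5 : 0 < ‖B.adjoint F‖ := lt_of_lt_of_le (by positivity) h4
    have h6 : ‖B.adjoint F‖ ≤ b⁻¹ * ‖F‖ := by
      refine le_of_mul_le_mul_right ?_ h5
      calc _ = ‖B.adjoint F‖ ^ 2 := by ring
        _ ≤ _ := h1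
        _ = _ := by ring
    have h7 : c ≤ b⁻¹ := le_of_mul_le_mul_right (h4.trans h6) hpos
    have h8 : b⁻¹ ≤ c / 2 := by
      rw [← inv_div]; exact inv_anti₀ (by positivity) (le_max_right _ _)
    linarith
  have h0 := measure_eq_zero_of_indicatorConstLp_eq_zero hs _ hF0
  have h0' : ∀ᵐ x ∂μ, x ∉ s := by simpa [ae_iff] using h0
  refine ⟨a, b, ha, le_max_left _ _, ?_⟩
  filter_upwards [h0', hlb] with x hx hx'
  exact ⟨hx', not_lt.1 hx⟩

end Multiplication

/-! ### Periodization and the circle of length T -/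

section Circle

open AddCircle

variable {T : ℝ} [hT : Fact (0 < T)]

theorem setLIntegral_Ioc_coe (t : ℝ) (f : AddCircle T → ℝ≥0∞) :
    ∫⁻ x in Set.Ioc t (t + T), f x = ENNReal.ofReal T * ∫⁻ x, f x ∂haarAddCircle := by
  rw [AddCircle.lintegral_preimage, volume_eq_smul_haarAddCircle, lintegral_smul_measure,
    smul_eq_mul]

theorem setLIntegral_Ioc_nsmul_coe_le (t : ℝ) (f : AddCircle T → ℝ≥0∞) (N : ℕ) :
    ∫⁻ x in Set.Ioc t (t + N * T), f x ≤ N * (ENNReal.ofReal T * ∫⁻ x, f x ∂haarAddCircle) := by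
  induction N with
  | zero => simp
  | succ N ih =>
    have hsub : Set.Ioc t (t + (N + 1 : ℕ) * T) ⊆
        Set.Ioc t (t + N * T) ∪ Set.Ioc (t + N * T) (t + N * T + T) := by
      intro x hx
      rcases le_or_gt x (t + N * T) with h | h
      · exact Or.inl ⟨hx.1, h⟩
      · refine Or.inr ⟨h, hx.2.trans_eq ?_⟩
        push_cast
        ring
    calc _ ≤ _ := lintegral_mono_set hsub
      _ ≤ _ := lintegral_union_le _ _ _
      _ ≤ _ := add_le_add ih (setLIntegral_Ioc_coe _ f).le
      _ = _ := by push_cast; ring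

/-- Integrals of periodic functions over bounded intervals are controlled by the circle. -/
theorem exists_setLIntegral_Icc_coe_le (x y : ℝ) : ∃ C : ℝ≥0∞, C ≠ ∞ ∧
    ∀ f : AddCircle T → ℝ≥0∞, ∫⁻ z in Set.Icc x y, f z ≤ C * ∫⁻ z, f z ∂haarAddCircle := by
  obtain ⟨N, hN⟩ := exists_nat_ge ((y - x + T) / T)
  rw [div_le_iff₀ hT.out] at hN
  refine ⟨N * ENNReal.ofReal T, by finiteness, fun f => ?_⟩
  rw [mul_assoc]
  -- Starting at x - T puts x itself inside the half-open interval; N was chosen with y ≤ x - T +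
  -- NT.
  refine (lintegral_mono_set ?_).trans (setLIntegral_Ioc_nsmul_coe_le (x - T) f N)
  intro z hz
  have := hT.out
  exact ⟨by linarith [hz.1], by linarith [hz.2]⟩

/-- The half-open interval is a fundamental domain for translation by multiples of T. -/
theorem lintegral_eq_setLIntegral_tsum {h : ℝ → ℝ≥0∞} (hh : AEMeasurable h) :
    ∫⁻ x, h x = ∫⁻ x in Set.Ioc 0 T, ∑' n : ℤ, h (x + n * T) := by
  have h1 := (isAddFundamentalDomain_Ioc hT.out 0).lintegral_eq_tsum'' h
  let e : ℤ → AddSubgroup.zmultiples T := fun n => ⟨n • T, n, rfl⟩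
  have hb : Function.Bijective e := by
    constructor
    · intro m n hmn
      have : m • T = n • T := congrArg Subtype.val hmn
      exact (zsmul_left_strictMono hT.out).injective this
    · rintro ⟨_, n, rfl⟩
      exact ⟨n, rfl⟩
  rw [h1, zero_add, lintegral_tsum fun n => ?_, ← (Equiv.ofBijective e hb).tsum_eq]
  · refine tsum_congr fun n => lintegral_congr fun x => ?_
    have : (Equiv.ofBijective e hb n : AddSubgroup.zmultiples T) +ᵥ x = x + n * T := by
      change n • T + x = _
      rw [zsmul_eq_mul, add_comm]
    rw [this]
  · exact (hh.comp_quasiMeasurePreserving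
      (measurePreserving_add_right volume (n * T)).quasiMeasurePreserving).restrict

/-- An interval of length `T` is, up to a null set, a half-open interval of length `T`. -/
theorem exists_ae_eq_Ioc_of_ordConnected {E : Set ℝ} (hE : E.OrdConnected)
    (hvol : volume E = ENNReal.ofReal T) : ∃ a, E =ᵐ[volume] Set.Ioc a (a + T) := by
  have hT0 := hT.out
  have hne : E.Nonempty := by
    by_contra h
    rw [Set.not_nonempty_iff_eq_empty] at h
    rw [h, measure_empty] at hvol
    exact absurd hvol.symm (by simpa using hT0)
  -- Order-connectedness bounds E, which then lies between the open and closed intervals with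
  -- endpoints inf E and sup E.
  have hlen : ∀ u ∈ E, ∀ v ∈ E, v - u ≤ T := fun u hu v hv => by
    have := measure_mono (μ := volume) (hE.out hu hv)
    rw [hvol, Real.volume_Icc] at this
    exact (ENNReal.ofReal_le_ofReal_iff hT0.le).1 this
  obtain ⟨w, hw⟩ := hne
  have hbb : BddBelow E := ⟨w - T, fun u hu => by linarith [hlen u hu w hw]⟩
  have hba : BddAbove E := ⟨w + T, fun u hu => by linarith [hlen w hw u hu]⟩
  have h1 : E ⊆ Set.Icc (sInf E) (sSup E) := fun u hu => ⟨csInf_le hbb hu, le_csSup hba hu⟩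
  have h2 : Set.Ioo (sInf E) (sSup E) ⊆ E := fun u hu => by
    obtain ⟨p, hp, hp'⟩ := exists_lt_of_csInf_lt ⟨w, hw⟩ hu.1
    obtain ⟨q, hq, hq'⟩ := exists_lt_of_lt_csSup ⟨w, hw⟩ hu.2
    exact hE.out hp hq ⟨hp'.le, hq'.le⟩
  have h3 : sSup E - sInf E = T := by
    have h4 := measure_mono (μ := volume) h1
    have h5 := measure_mono (μ := volume) h2
    rw [hvol, Real.volume_Icc] at h4
    rw [hvol, Real.volume_Ioo] at h5
    refine le_antisymm ((ENNReal.ofReal_le_ofReal_iff hT0.le).1 h5) ?_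
    by_contra h
    exact absurd h4 (not_le.2 ((ENNReal.ofReal_lt_ofReal_iff hT0).2 (not_le.1 h)))
  refine ⟨sInf E, ?_⟩
  have h6 : sInf E + T = sSup E := by linarith
  rw [h6]
  refine (LE.le.eventuallyLE h1).trans Ioc_ae_eq_Icc.symm.le |>.antisymm ?_
  exact Ioo_ae_eq_Ioc.symm.le.trans (LE.le.eventuallyLE h2)

/-- Any interval of length T represents the circle up to a null set; this is why the position of E
is irrelevant. -/
theorem ae_restrict_coe_iff {E : Set ℝ} (hE : E.OrdConnected)
    (hvol : volume E = ENNReal.ofReal T) {p : AddCircle T → Prop}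
    (hp : MeasurableSet {x | p x}) :
    (∀ᵐ x : ℝ ∂volume.restrict E, p (x : AddCircle T)) ↔ ∀ᵐ x ∂(haarAddCircle (T := T)), p x := by
  obtain ⟨a, ha⟩ := exists_ae_eq_Ioc_of_ordConnected hE hvol
  have h := ae_map_iff (μ := volume.restrict (Set.Ioc a (a + T)))
    (f := fun x : ℝ => (x : AddCircle T)) AddCircle.measurable_mk'.aemeasurable hp
  rw [Measure.restrict_congr_set ha, ← h, (AddCircle.measurePreserving_mk T a).map_eq,
    volume_eq_smul_haarAddCircle, Measure.ae_ennreal_smul_measure_eq]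
  simpa using hT.out

end Circle

/-! ### Translation and the L² Fourier transform -/

section Translation

/-- Translation on `L²(ℝ)`. -/
def translate (a : ℝ) (f : Lp ℂ 2 (volume : Measure ℝ)) : Lp ℂ 2 (volume : Measure ℝ) :=
  Lp.compMeasurePreserving (fun t => t - a) (measurePreserving_sub_right volume a) f

theorem continuous_translate (a : ℝ) : Continuous (translate a) :=
  (Lp.isometry_compMeasurePreserving (measurePreserving_sub_right volume a)).continuous

/-- The phase `exp(-2πi a w)`. -/
def phase (a w : ℝ) : ℂ := Complex.exp (((-2 * Real.pi * a * w : ℝ) : ℂ) * Complex.I)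

theorem norm_phase (a w : ℝ) : ‖phase a w‖ = 1 := Complex.norm_exp_ofReal_mul_I _

theorem continuous_phase (a : ℝ) : Continuous (phase a) := by
  unfold phase; fun_prop

theorem fourier_comp_sub (f : ℝ → ℂ) (a w : ℝ) :
    𝓕 (fun t => f (t - a)) w = phase a w * 𝓕 f w := by
  rw [Real.fourier_real_eq_integral_exp_smul, Real.fourier_real_eq_integral_exp_smul,
    ← integral_const_mul,
    ← integral_sub_right_eq_self
      (fun v => phase a w * Complex.exp (((-2 * Real.pi * v * w : ℝ) : ℂ) * Complex.I) • f v) a]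
  congr 1
  ext v
  rw [smul_eq_mul, smul_eq_mul, ← mul_assoc, phase, ← Complex.exp_add]
  congr 2
  push_cast
  ring

/-- The `L²` Fourier transform turns translation into modulation. -/
theorem fourier_translate (a : ℝ) (f : Lp ℂ 2 (volume : Measure ℝ)) :
    (𝓕 (translate a f) : Lp ℂ 2 (volume : Measure ℝ)) =ᵐ[volume]
      fun w => phase a w * (𝓕 f : Lp ℂ 2 (volume : Measure ℝ)) w := by
  obtain ⟨M, hM⟩ := exists_mul_clm (μ := (volume : Measure ℝ)) (g := phase a) (β := 1)
    (continuous_phase a).aestronglyMeasurable (Eventually.of_forall fun w => (norm_phase a w).le)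
  suffices h : ∀ f : Lp ℂ 2 (volume : Measure ℝ), 𝓕 (translate a f) = M (𝓕 f) by
    rw [h]; exact hM _
  intro f
  -- Both sides are continuous in f, so the integral formula on Schwartz functions suffices.
  refine DenseRange.induction_on
    (SchwartzMap.denseRange_toLpCLM (E := ℝ) (F := ℂ) (p := 2) (μ := volume)
      ENNReal.ofNat_ne_top) f ?_ ?_
  · exact isClosed_eq ((Lp.fourierTransformₗᵢ ℝ ℂ).continuous.comp (continuous_translate a))
      (M.continuous.comp (Lp.fourierTransformₗᵢ ℝ ℂ).continuous)
  · intro h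
    have h1 : translate a (h.toLp 2) = (h.compSubConstCLM ℂ a).toLp 2 := rfl
    change 𝓕 (translate a (h.toLp 2)) = M (𝓕 (h.toLp 2))
    rw [h1, SchwartzMap.toLp_fourier_eq, SchwartzMap.toLp_fourier_eq]
    refine Lp.ext ?_
    filter_upwards [hM ((𝓕 h).toLp 2), (𝓕 h).coeFn_toLp 2,
      (𝓕 (h.compSubConstCLM ℂ a)).coeFn_toLp 2] with w h2 h3 h4
    rw [h2, h3, h4]
    exact fourier_comp_sub h a w

end Translation

open AddCircle

/-! ### The exponential basis exp(-ibnξ) -/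

section Basis

theorem enorm_sq_eq_lintegral {α : Type*} [MeasurableSpace α] {μ : Measure α} (f : Lp ℂ 2 μ) :
    ‖f‖ₑ ^ 2 = ∫⁻ x, ‖f x‖ₑ ^ 2 ∂μ := by
  rw [Lp.enorm_def]
  have h := eLpNorm_nnreal_pow_eq_lintegral (μ := μ) (f := f) (p := 2) two_ne_zero
  simpa using h

theorem coeFn_sum_smul {α : Type*} [MeasurableSpace α] {μ : Measure α} (s : Finset ℤ) (d : ℤ → ℂ)
    {f : ℤ → Lp ℂ 2 μ} {g : ℤ → α → ℂ} (hfg : ∀ n, f n =ᵐ[μ] g n) :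
    (∑ n ∈ s, d n • f n : Lp ℂ 2 μ) =ᵐ[μ] fun x => ∑ n ∈ s, d n * g n x := by
  refine (Lp.coeFn_finsetSum s _).trans ?_
  have h2 : ∀ᵐ x ∂μ, ∀ n, (d n • f n : Lp ℂ 2 μ) x = d n * g n x := by
    rw [ae_all_iff]
    intro n
    filter_upwards [hfg n, Lp.coeFn_smul (d n) (f n)] with x h3 h4
    rw [h4, Pi.smul_apply, h3, smul_eq_mul]
  filter_upwards [h2] with x hx
  rw [Finset.sum_apply]
  exact Finset.sum_congr rfl fun n _ => hx n

variable (θ : ℝ)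

theorem coefB_ne_zero [h : Fact (Real.sin θ ≠ 0)] : coefB θ ≠ 0 := inv_ne_zero h.out

instance [Fact (Real.sin θ ≠ 0)] : Fact (0 < period θ) :=
  ⟨div_pos Real.two_pi_pos (abs_pos.2 (coefB_ne_zero θ))⟩

theorem coefC_ne_zero : coefC θ ≠ 0 := by
  have h : (1 - Complex.I * (Real.cot θ : ℂ)) / (2 * (Real.pi : ℂ)) ≠ 0 := by
    -- The numerator has real part 1.
    refine div_ne_zero (fun h => ?_) (by simp [Real.pi_ne_zero])
    have := congrArg Complex.re h
    simp only [Complex.sub_re, Complex.one_re, Complex.mul_re, Complex.I_re, Complex.I_im,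
      Complex.ofReal_im, Complex.zero_re] at this
    norm_num at this
  rw [coefC, Ne, Complex.cpow_eq_zero_iff]
  exact fun h' => h h'.1

theorem norm_eta (t : ℝ) : ‖eta θ t‖ = ‖coefC θ‖ := by simp [eta, norm_chirp]

/-- The sign change of the integers that turns `exp(-ibnξ)` into a standard character. -/
def signEquiv : ℤ ≃ ℤ := if 0 < coefB θ then Equiv.neg ℤ else Equiv.refl ℤ

/-- Since 2π/Δ = |b|, the standard characters are exp(i|b|nξ); the sign of b decides whether n must
be negated. -/
theorem fourier_signEquiv_coe [Fact (Real.sin θ ≠ 0)] (n : ℤ) (ξ : ℝ) :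
    fourier (signEquiv θ n) (ξ : AddCircle (period θ)) =
      Complex.exp (((-(coefB θ * n * ξ) : ℝ) : ℂ) * Complex.I) := by
  have hb := coefB_ne_zero θ
  have hb' : ((coefB θ : ℝ) : ℂ) ≠ 0 := Complex.ofReal_ne_zero.2 hb
  have hπ : (Real.pi : ℂ) ≠ 0 := Complex.ofReal_ne_zero.2 Real.pi_ne_zero
  rw [fourier_coe_apply, period, signEquiv]
  congr 1
  split_ifs with h
  · rw [abs_of_pos h]
    simp only [Equiv.neg_apply]
    push_cast
    field_simp
  · rw [abs_of_nonpos (not_lt.1 h)]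
    simp only [Equiv.refl_apply]
    push_cast
    field_simp

/-- The functions `exp(-ibnξ)`, `n ∈ ℤ`, as a Hilbert basis of `L²` of the circle. -/
def expBasis [Fact (Real.sin θ ≠ 0)] :
    HilbertBasis ℤ ℂ (Lp ℂ 2 (haarAddCircle (T := period θ))) :=
  HilbertBasis.mk (orthonormal_fourier.comp _ (signEquiv θ).injective) <| by
    rw [(signEquiv θ).surjective.range_comp]
    exact (span_fourierLp_closure_eq_top (by norm_num)).ge

theorem coeFn_expBasis [Fact (Real.sin θ ≠ 0)] (n : ℤ) :
    expBasis θ n =ᵐ[haarAddCircle] fun x => fourier (signEquiv θ n) x := by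
  rw [expBasis, HilbertBasis.coe_mk]
  exact coeFn_fourierLp 2 (signEquiv θ n)

/-- Parseval for trigonometric polynomials, in extended nonnegative form. -/
theorem lintegral_fourier_sum [Fact (Real.sin θ ≠ 0)] (s : Finset ℤ) (d : ℤ → ℂ) :
    ∫⁻ x, ‖∑ n ∈ s, d n * fourier (signEquiv θ n) x‖ₑ ^ 2 ∂(haarAddCircle (T := period θ)) =
      ENNReal.ofReal (∑ n ∈ s, ‖d n‖ ^ 2) := by
  have h1 := coeFn_sum_smul s d (coeFn_expBasis θ)
  have h5 : ‖∑ n ∈ s, d n • expBasis θ n‖ ^ 2 = ∑ n ∈ s, ‖d n‖ ^ 2 := by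
    have h6 := (expBasis θ).orthonormal.inner_sum d d s
    rw [inner_self_eq_norm_sq_to_K] at h6
    have h7 : ∀ n, conj (d n) * d n = ((‖d n‖ ^ 2 : ℝ) : ℂ) := fun n => by
      rw [Complex.conj_mul']; push_cast; rfl
    simp only [h7] at h6
    rw [← Complex.ofReal_sum] at h6
    exact Complex.ofReal_injective ((Complex.ofReal_pow _ 2).trans h6)
  rw [← h5, ENNReal.ofReal_pow (norm_nonneg _), ofReal_norm, enorm_sq_eq_lintegral]
  exact lintegral_congr_ae (h1.mono fun x hx => by simp only [hx])

end Basis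

/-! ### Riesz bounds for the generators -/

section Atoms

variable (θ : ℝ) {φ : ℝ → ℂ} (hφ : MemLp φ 2 volume)

theorem atom_coeFn (n : ℤ) : atom θ hφ n =ᵐ[volume] fun t => eta θ t * modulate θ φ (t - n) :=
  (memLp_atom θ hφ n).coeFn_toLp

theorem lintegral_comp_mul_left {a : ℝ} (ha : a ≠ 0) {h : ℝ → ℝ≥0∞} (hh : Measurable h) :
    ∫⁻ w, h w = ENNReal.ofReal |a| * ∫⁻ ξ, h (a * ξ) := by
  conv_lhs => rw [← Real.smul_map_volume_mul_left ha]
  rw [lintegral_smul_measure, smul_eq_mul, lintegral_map hh (measurable_const_mul a)]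

/-- The factor η_θ has constant modulus |c(θ)|, and Plancherel turns the translates of λ_θφ into
phases. -/
theorem enorm_sum_atom_sq (s : Finset ℤ) (d : ℤ → ℂ) :
    ‖∑ n ∈ s, d n • atom θ hφ n‖ₑ ^ 2 = ‖coefC θ‖ₑ ^ 2 *
      ∫⁻ w, ‖∑ n ∈ s, d n * phase n w‖ₑ ^ 2 *
        ‖(𝓕 ((memLp_modulate θ hφ).toLp (modulate θ φ)) : Lp ℂ 2 (volume : Measure ℝ)) w‖ₑ ^ 2 := by
  set Ψ := (memLp_modulate θ hφ).toLp (modulate θ φ) with hΨ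
  have htr : ∀ n : ℤ, translate n Ψ =ᵐ[volume] fun t => modulate θ φ (t - n) := fun n => by
    rw [hΨ, translate, Lp.toLp_compMeasurePreserving]
    exact MemLp.coeFn_toLp _
  have hF : (𝓕 (∑ n ∈ s, d n • translate n Ψ) : Lp ℂ 2 (volume : Measure ℝ)) =
      ∑ n ∈ s, d n • 𝓕 (translate n Ψ) := by
    change Lp.fourierTransformₗᵢ ℝ ℂ _ = _
    rw [map_sum]
    simp only [map_smul]
    rfl
  have h1 : ‖∑ n ∈ s, d n • translate n Ψ‖ₑ ^ 2 =
      ∫⁻ w, ‖∑ n ∈ s, d n * phase n w‖ₑ ^ 2 *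
        ‖(𝓕 Ψ : Lp ℂ 2 (volume : Measure ℝ)) w‖ₑ ^ 2 := by
    rw [← ofReal_norm, ← Lp.norm_fourier_eq, ofReal_norm, hF, enorm_sq_eq_lintegral]
    refine lintegral_congr_ae ?_
    filter_upwards [coeFn_sum_smul s d fun n : ℤ => fourier_translate n Ψ] with w hw
    rw [hw, ← mul_pow, ← enorm_mul, Finset.sum_mul]
    simp only [mul_assoc]
  rw [← h1, enorm_sq_eq_lintegral, enorm_sq_eq_lintegral, ← lintegral_const_mul' _ _ (by finiteness)]
  refine lintegral_congr_ae ?_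
  filter_upwards [coeFn_sum_smul s d htr, coeFn_sum_smul s d (atom_coeFn θ hφ)] with t h2 h3
  have h4 : ‖eta θ t‖ₑ = ‖coefC θ‖ₑ := by rw [← ofReal_norm, norm_eta, ofReal_norm]
  rw [h2, h3, ← mul_pow, ← h4, ← enorm_mul, Finset.mul_sum]
  congr 3
  exact funext fun n => by ring

theorem measurable_frft : Measurable (frft θ hφ) := by
  refine Measurable.mul (measurable_const.mul (continuous_chirp θ).measurable) ?_
  exact (Lp.stronglyMeasurable _).measurable.comp (by fun_prop)

variable [Fact (Real.sin θ ≠ 0)]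

/-- After the substitution w = bξ/2π the trigonometric polynomial is Δ-periodic, so periodizing the
integral gathers the remaining factor into G. -/
theorem enorm_sum_atom_sq_eq_frft (s : Finset ℤ) (d : ℤ → ℂ) :
    ENNReal.ofReal (period θ) * ‖∑ n ∈ s, d n • atom θ hφ n‖ₑ ^ 2 =
      ∫⁻ ξ in Set.Ioc 0 (period θ),
        ‖∑ n ∈ s, d n * fourier (signEquiv θ n) (ξ : AddCircle (period θ))‖ₑ ^ 2 *
          sumG θ hφ ξ := by
  have hb := coefB_ne_zero θ
  have hT : 0 < period θ := Fact.out
  have ha : coefB θ / (2 * Real.pi) ≠ 0 := div_ne_zero hb Real.two_pi_pos.ne'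
  have hphase : ∀ (n : ℤ) (ξ : ℝ), phase n (coefB θ / (2 * Real.pi) * ξ) =
      fourier (signEquiv θ n) (ξ : AddCircle (period θ)) := fun n ξ => by
    rw [fourier_signEquiv_coe, phase]
    congr 3
    field_simp
  have hmeas : Measurable fun ξ : ℝ =>
      ‖∑ n ∈ s, d n * fourier (signEquiv θ n) (ξ : AddCircle (period θ))‖ₑ ^ 2 := by
    refine Measurable.pow_const (Measurable.enorm ?_) 2
    exact Finset.measurable_sum _ fun n _ => measurable_const.mul
      ((fourier (signEquiv θ n)).continuous.measurable.comp AddCircle.measurable_mk')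
  rw [enorm_sum_atom_sq, lintegral_comp_mul_left ha]
  · have h1 : ENNReal.ofReal (period θ) * ENNReal.ofReal |coefB θ / (2 * Real.pi)| = 1 := by
      rw [← ENNReal.ofReal_mul hT.le, period, abs_div, abs_of_pos Real.two_pi_pos]
      have := abs_pos.2 hb
      have := Real.pi_pos
      rw [div_mul_div_comm, mul_comm, div_self (by positivity), ENNReal.ofReal_one]
    rw [mul_left_comm, ← mul_assoc (ENNReal.ofReal (period θ)), h1, one_mul,
      ← lintegral_const_mul' _ _ (by finiteness)]
    have h2 : ∀ ξ, ‖coefC θ‖ₑ ^ 2 * (‖∑ n ∈ s, d n * phase n (coefB θ / (2 * Real.pi) * ξ)‖ₑ ^ 2 *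
          ‖(𝓕 ((memLp_modulate θ hφ).toLp (modulate θ φ)) : Lp ℂ 2 (volume : Measure ℝ))
            (coefB θ / (2 * Real.pi) * ξ)‖ₑ ^ 2) =
        ‖∑ n ∈ s, d n * fourier (signEquiv θ n) (ξ : AddCircle (period θ))‖ₑ ^ 2 *
          ‖frft θ hφ ξ‖ₑ ^ 2 := fun ξ => by
      have h3 : ‖chirp θ ξ‖ₑ = 1 := by rw [← ofReal_norm, norm_chirp, ENNReal.ofReal_one]
      simp only [hphase]
      rw [frft, enorm_mul, enorm_mul, h3, mul_one, mul_pow, mul_left_comm, div_mul_eq_mul_div]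
    rw [lintegral_congr h2]
    refine (lintegral_eq_setLIntegral_tsum (T := period θ)
      (hmeas.mul ((measurable_frft θ hφ).enorm.pow_const 2)).aemeasurable).trans ?_
    simp only [Pi.mul_apply]
    refine lintegral_congr fun ξ => ?_
    rw [sumG, ← ENNReal.tsum_mul_left]
    refine tsum_congr fun k => ?_
    have h4 : ((ξ + k * period θ : ℝ) : AddCircle (period θ)) = (ξ : AddCircle (period θ)) := by
      have := AddCircle.coe_add (period θ) ξ (k * period θ)
      rw [this, ← zsmul_eq_mul, AddCircle.coe_zsmul, AddCircle.coe_period, smul_zero, add_zero]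
    rw [h4]
  · refine Measurable.mul ?_ ((Lp.stronglyMeasurable _).measurable.enorm.pow_const 2)
    refine Measurable.pow_const (Measurable.enorm ?_) 2
    exact Finset.measurable_sum _ fun n _ => measurable_const.mul (continuous_phase n).measurable

/-- The two-sided bound for finite combinations of the atoms. -/
theorem norm_sum_atom_sq_bounds {A B : ℝ} (hA : 0 < A) (hAB : A ≤ B)
    (hG : ∀ᵐ ξ ∂(volume.restrict (Set.Icc 0 (period θ))),
      ENNReal.ofReal A ≤ sumG θ hφ ξ ∧ sumG θ hφ ξ ≤ ENNReal.ofReal B)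
    (s : Finset ℤ) (d : ℤ → ℂ) :
    A * ∑ n ∈ s, ‖d n‖ ^ 2 ≤ ‖∑ n ∈ s, d n • atom θ hφ n‖ ^ 2 ∧
      ‖∑ n ∈ s, d n • atom θ hφ n‖ ^ 2 ≤ B * ∑ n ∈ s, ‖d n‖ ^ 2 := by
  have hT : 0 < period θ := Fact.out
  have hT' : ENNReal.ofReal (period θ) ≠ 0 := by simpa using hT
  have hB := hA.le.trans hAB
  have hG' := ae_restrict_of_ae_restrict_of_subset Set.Ioc_subset_Icc_self hG
  -- With G replaced by a constant c the integral is computed by Parseval; c is then A or B.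
  have key : ∀ {c : ℝ}, 0 ≤ c → ∫⁻ ξ in Set.Ioc 0 (period θ),
      ‖∑ n ∈ s, d n * fourier (signEquiv θ n) (ξ : AddCircle (period θ))‖ₑ ^ 2 *
        ENNReal.ofReal c =
      ENNReal.ofReal (period θ) * ENNReal.ofReal (c * ∑ n ∈ s, ‖d n‖ ^ 2) := fun {c} hc => by
    have h1 := setLIntegral_Ioc_coe (T := period θ) 0 fun x =>
      ‖∑ n ∈ s, d n * fourier (signEquiv θ n) x‖ₑ ^ 2
    rw [lintegral_fourier_sum, zero_add] at h1
    rw [lintegral_mul_const' _ _ (by finiteness), h1, mul_assoc, mul_comm c,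
      ENNReal.ofReal_mul (by positivity)]
  have h2 : ‖∑ n ∈ s, d n • atom θ hφ n‖ₑ ^ 2 =
      ENNReal.ofReal (‖∑ n ∈ s, d n • atom θ hφ n‖ ^ 2) := by
    rw [ENNReal.ofReal_pow (norm_nonneg _), ofReal_norm]
  have h3 := enorm_sum_atom_sq_eq_frft θ hφ s d
  rw [h2] at h3
  constructor
  · rw [← ENNReal.ofReal_le_ofReal_iff (by positivity),
      ← ENNReal.mul_le_mul_iff_right hT' ENNReal.ofReal_ne_top, h3, ← key hA.le]
    refine lintegral_mono_ae ?_
    filter_upwards [hG'] with ξ hξ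
    gcongr
    exact hξ.1
  · rw [← ENNReal.ofReal_le_ofReal_iff (by positivity),
      ← ENNReal.mul_le_mul_iff_right hT' ENNReal.ofReal_ne_top, h3, ← key hB]
    refine lintegral_mono_ae ?_
    filter_upwards [hG'] with ξ hξ
    gcongr
    exact hξ.2


end Atoms

/-! ### Point values in V_θ(φ) -/

section Value

theorem exists_lp_mul {u : ℤ → ℂ} {C : ℝ} (hu : ∀ n, ‖u n‖ ≤ C) (c : lp (fun _ : ℤ => ℂ) 2) :
    ∃ d : lp (fun _ : ℤ => ℂ) 2, ∀ n, d n = u n * c n := by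
  refine ⟨⟨fun n => u n * c n, memℓp_gen ?_⟩, fun n => rfl⟩
  have h := (hasSum_norm_sq_lp c).summable.mul_left (C ^ 2)
  have h' : ∀ n, ‖u n * c n‖ ^ 2 ≤ C ^ 2 * ‖c n‖ ^ 2 := fun n => by
    rw [norm_mul, mul_pow]
    gcongr
    exact hu n
  simpa using Summable.of_nonneg_of_le (fun n => by positivity) h' h

/-- A diagonal operator on `ℓ²` with entries of constant modulus is an isomorphism. -/
theorem exists_lp_diagonal_equiv {u : ℤ → ℂ} {C : ℝ} (hC : 0 < C) (hu : ∀ n, ‖u n‖ = C) :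
    ∃ D : lp (fun _ : ℤ => ℂ) 2 ≃L[ℂ] lp (fun _ : ℤ => ℂ) 2, ∀ c n, D c n = u n * c n := by
  have hne : ∀ n, u n ≠ 0 := fun n => norm_pos_iff.1 (by rw [hu]; exact hC)
  choose d hd using fun c => exists_lp_mul (u := u) (fun n => (hu n).le) c
  choose d' hd' using fun c => exists_lp_mul (u := fun n => (u n)⁻¹) (C := C⁻¹)
    (fun n => by rw [norm_inv, hu]) c
  let D₀ : lp (fun _ : ℤ => ℂ) 2 ≃ₗ[ℂ] lp (fun _ : ℤ => ℂ) 2 :=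
    { toFun := d
      invFun := d'
      map_add' := fun b c => lp.ext (funext fun n => by simp [hd, mul_add])
      map_smul' := fun a c => lp.ext (funext fun n => by simp [hd, mul_left_comm])
      left_inv := fun c => lp.ext (funext fun n => by simp [hd, hd', hne])
      right_inv := fun c => lp.ext (funext fun n => by simp [hd, hd', hne]) }
  have hnorm : ∀ c, ‖D₀ c‖ = C * ‖c‖ := fun c => by
    have h1 : ‖D₀ c‖ ^ 2 = (C * ‖c‖) ^ 2 := by
      refine (hasSum_norm_sq_lp (d c)).unique ?_
      rw [mul_pow]
      refine ((hasSum_norm_sq_lp c).mul_left (C ^ 2)).congr_fun fun n => ?_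
      rw [hd, norm_mul, hu, mul_pow]
    exact (pow_left_inj₀ (norm_nonneg _) (by positivity) two_ne_zero).1 h1
  refine ⟨D₀.toContinuousLinearEquivOfBounds C C⁻¹ (fun c => (hnorm c).le) (fun c => ?_), hd⟩
  have h2 := hnorm (D₀.symm c)
  rw [D₀.apply_symm_apply] at h2
  rw [h2, inv_mul_cancel_left₀ hC.ne']

variable (θ : ℝ) {φ : ℝ → ℂ} (hφ : MemLp φ 2 volume)

instance : CompleteSpace (chirpSpace θ hφ) := by
  unfold chirpSpace; infer_instance

/-- The atoms as elements of `V_θ(φ)`. -/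
def spaceAtom (n : ℤ) : chirpSpace θ hφ :=
  ⟨atom θ hφ n, Submodule.le_topologicalClosure _ (Submodule.subset_span ⟨n, rfl⟩)⟩

/-- Closure in the subspace is the preimage of closure in L²(ℝ). -/
theorem span_spaceAtom_closure :
    (Submodule.span ℂ (Set.range (spaceAtom θ hφ))).topologicalClosure = ⊤ := by
  rw [eq_top_iff]
  intro f _
  have h1 : (Submodule.span ℂ (Set.range (spaceAtom θ hφ))).map (chirpSpace θ hφ).subtype =
      Submodule.span ℂ (Set.range (atom θ hφ)) := by
    rw [Submodule.map_span, ← Set.range_comp]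
    rfl
  have h2 : (f : Lp ℂ 2 (volume : Measure ℝ)) ∈ closure
      (((Submodule.span ℂ (Set.range (spaceAtom θ hφ))).map (chirpSpace θ hφ).subtype :
        Submodule ℂ (Lp ℂ 2 (volume : Measure ℝ))) : Set (Lp ℂ 2 (volume : Measure ℝ))) := by
    rw [h1]; exact f.2
  change f ∈ closure _
  rw [Topology.IsInducing.subtypeVal.closure_eq_preimage_closure_image]
  exact h2

theorem isRieszBasis_spaceAtom [Fact (Real.sin θ ≠ 0)]
    (hG : ∃ A B : ℝ, 0 < A ∧ A ≤ B ∧ ∀ᵐ ξ ∂(volume.restrict (Set.Icc 0 (period θ))),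
      ENNReal.ofReal A ≤ sumG θ hφ ξ ∧ sumG θ hφ ξ ≤ ENNReal.ofReal B) :
    IsRieszBasis (spaceAtom θ hφ) := by
  obtain ⟨A, B, hA, hAB, h⟩ := hG
  refine IsRieszBasis.of_finite_bounds (span_spaceAtom_closure θ hφ) hA hAB fun s c => ?_
  have h1 := norm_sum_atom_sq_bounds θ hφ hA hAB h s c
  have h2 : ((∑ n ∈ s, c n • spaceAtom θ hφ n : chirpSpace θ hφ) : Lp ℂ 2 (volume : Measure ℝ)) =
      ∑ n ∈ s, c n • atom θ hφ n := by
    simp [spaceAtom]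
  rw [← h2] at h1
  exact h1

variable {θ hφ} {e : lp (fun _ : ℤ => ℂ) 2 ≃L[ℂ] chirpSpace θ hφ}

theorem hasSum_atom
    (he : ∀ c, HasSum (fun n => c n • spaceAtom θ hφ n) (e c))
    (f : chirpSpace θ hφ) :
    HasSum (fun n => e.symm f n • atom θ hφ n) (f : Lp ℂ 2 (volume : Measure ℝ)) := by
  have h := (he (e.symm f)).mapL (chirpSpace θ hφ).subtypeL
  rw [e.apply_symm_apply] at h
  exact h

/-- Removes the choice in `value`: injectivity of `e` identifies λ_θ(n)c(n) with the coordinates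
`e.symm f n`, for whichever c was chosen. -/
theorem value_eq_tsum
    (he : ∀ c, HasSum (fun n => c n • spaceAtom θ hφ n) (e c))
    (f : chirpSpace θ hφ) (t : ℝ) :
    value θ hφ f t = eta θ t * ∑' n, e.symm f n * modulate θ φ (t - n) := by
  have hex : ∃ c : lp (fun _ : ℤ => ℂ) 2, IsFracConv θ hφ c f := by
    -- The conjugate chirp cancels the unimodular factor λ_θ(n) built into `IsFracConv`.
    obtain ⟨c, hc⟩ := exists_lp_mul (u := fun n : ℤ => conj (chirp θ n)) (C := 1)
      (fun n => by simp [norm_chirp]) (e.symm f)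
    refine ⟨c, (hasSum_atom he f).congr_fun fun n => ?_⟩
    rw [hc, ← mul_assoc, Complex.mul_conj']
    simp [norm_chirp]
  rw [value, dif_pos hex, fracConv]
  have hspec := hex.choose_spec
  obtain ⟨d, hd⟩ := exists_lp_mul (u := fun n : ℤ => chirp θ n) (C := 1)
      (fun n => by simp [norm_chirp]) hex.choose
  have h1 : e d = f := by
    refine Subtype.ext (((he d).mapL (chirpSpace θ hφ).subtypeL).unique ?_)
    refine HasSum.congr_fun hspec fun n => ?_
    simp [hd, spaceAtom]
  have h2 : e.symm f = d := by rw [← h1, e.symm_apply_apply]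
  rw [h2]
  simp only [hd]

theorem exists_lp_of_sumC_lt_top {t : ℝ} (ht : sumC θ φ t < ∞) :
    ∃ k : lp (fun _ : ℤ => ℂ) 2, (∀ n : ℤ, k n = conj (modulate θ φ (t - n))) ∧
      ENNReal.ofReal (‖k‖ ^ 2) = sumC θ φ t := by
  have h1 : ∀ n : ℤ, ‖modulate θ φ (t - n)‖ₑ ^ 2 =
      ENNReal.ofReal (‖modulate θ φ (t - n)‖ ^ 2) := fun n => by
    rw [ENNReal.ofReal_pow (norm_nonneg _), ofReal_norm]
  simp only [sumC, h1] at ht ⊢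
  have hs : Summable fun n : ℤ => ‖modulate θ φ (t - n)‖ ^ 2 := by
    have := ENNReal.summable_toReal ht.ne
    simpa [ENNReal.toReal_ofReal] using this
  let k : lp (fun _ : ℤ => ℂ) 2 :=
    ⟨fun n => conj (modulate θ φ (t - n)), memℓp_gen (by simpa using hs)⟩
  refine ⟨k, fun n => rfl, ?_⟩
  rw [← ENNReal.ofReal_tsum_of_nonneg (fun n => by positivity) hs]
  congr 1
  rw [← (hasSum_norm_sq_lp k).tsum_eq]
  exact tsum_congr fun n => by simp [k]

theorem hasSum_value
    (he : ∀ c, HasSum (fun n => c n • spaceAtom θ hφ n) (e c))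
    {t : ℝ} (ht : sumC θ φ t < ∞) (f : chirpSpace θ hφ) :
    HasSum (fun n => e.symm f n * (eta θ t * modulate θ φ (t - n))) (value θ hφ f t) := by
  obtain ⟨k, hk, -⟩ := exists_lp_of_sumC_lt_top (θ := θ) (φ := φ) ht
  have h := lp.summable_inner (𝕜 := ℂ) k (e.symm f)
  rw [value_eq_tsum he]
  have h2 : Summable fun n : ℤ => e.symm f n * modulate θ φ (t - n) := by
    simpa [hk, mul_comm] using h
  refine (h2.hasSum.mul_left _).congr_fun fun n => ?_
  ring

theorem value_eq_inner
    (he : ∀ c, HasSum (fun n => c n • spaceAtom θ hφ n) (e c))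
    {t : ℝ} {k : lp (fun _ : ℤ => ℂ) 2}
    (hk : ∀ n : ℤ, k n = conj (modulate θ φ (t - n))) (f : chirpSpace θ hφ) :
    value θ hφ f t = eta θ t * inner ℂ k (e.symm f) := by
  rw [value_eq_tsum he, lp.inner_eq_tsum]
  congr 1
  refine tsum_congr fun n => ?_
  simp [hk, mul_comm]

/-- Point evaluation is a bounded functional on `V_θ(φ)`. -/
theorem exists_value_clm
    (he : ∀ c, HasSum (fun n => c n • spaceAtom θ hφ n) (e c))
    {t : ℝ} (ht : sumC θ φ t < ∞) :
    ∃ L : chirpSpace θ hφ →L[ℂ] ℂ, ∀ f, L f = value θ hφ f t := by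
  obtain ⟨k, hk, -⟩ := exists_lp_of_sumC_lt_top (θ := θ) (φ := φ) ht
  refine ⟨(eta θ t • innerSL ℂ k) ∘L (e.symm : chirpSpace θ hφ →L[ℂ] _), fun f => ?_⟩
  rw [value_eq_inner he hk]
  rfl

/-- Cauchy–Schwarz in ℓ². The bound depends on t only through M, so norm convergence gives uniform
convergence wherever C_{φ,θ} is bounded. -/
theorem norm_value_le
    (he : ∀ c, HasSum (fun n => c n • spaceAtom θ hφ n) (e c))
    {t : ℝ} {M : ℝ≥0} (ht : sumC θ φ t ≤ M) (f : chirpSpace θ hφ) :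
    ‖value θ hφ f t‖ ≤ ‖coefC θ‖ * (√M * ‖e.symm f‖) := by
  obtain ⟨k, hk, hk'⟩ :=
    exists_lp_of_sumC_lt_top (θ := θ) (φ := φ) (ht.trans_lt ENNReal.coe_lt_top)
  rw [value_eq_inner he hk, norm_mul, norm_eta]
  refine mul_le_mul_of_nonneg_left ((norm_inner_le_norm _ _).trans ?_) (norm_nonneg _)
  refine mul_le_mul_of_nonneg_right (Real.le_sqrt_of_sq_le ?_) (norm_nonneg _)
  rw [← hk', ← ENNReal.ofReal_coe_nnreal] at ht
  exact (ENNReal.ofReal_le_ofReal_iff M.2).1 ht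

/-- The pointwise values represent the given `L²` class. -/
theorem value_ae_eq
    (he : ∀ c, HasSum (fun n => c n • spaceAtom θ hφ n) (e c))
    (hC : ∀ t, sumC θ φ t < ∞) (f : chirpSpace θ hφ) :
    (f : Lp ℂ 2 (volume : Measure ℝ)) =ᵐ[volume] value θ hφ f := by
  -- Symmetric partial sums form a sequence, from which L² convergence extracts an a.e. convergent
  -- subsequence; its limit must agree with the pointwise sum.
  let s : ℕ → Finset ℤ := fun N => Finset.Icc (-N) N
  have hs : Tendsto s atTop atTop := by
    refine tendsto_atTop_finset_of_monotone (fun M N h => ?_) fun n => ?_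
    · exact Finset.Icc_subset_Icc (by simpa using h) (by simpa using h)
    · refine ⟨n.natAbs, ?_⟩
      simp only [s, Finset.mem_Icc]
      omega
  have h1 := (hasSum_atom he f).comp hs
  have h2 := tendstoInMeasure_of_tendsto_Lp h1
  obtain ⟨ns, hns, h3⟩ := h2.exists_seq_tendsto_ae
  have h4 : ∀ᵐ t, ∀ N, (∑ n ∈ s N, e.symm f n • atom θ hφ n : Lp ℂ 2 (volume : Measure ℝ)) t =
      ∑ n ∈ s N, e.symm f n * (eta θ t * modulate θ φ (t - n)) :=
    ae_all_iff.2 fun N => coeFn_sum_smul (s N) (e.symm f) (atom_coeFn θ hφ)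
  filter_upwards [h3, h4] with t h5 h6
  have h7 := ((hasSum_value he (hC t) f).comp hs).comp hns.tendsto_atTop
  refine tendsto_nhds_unique h5 (h7.congr fun i => ?_)
  exact (h6 (ns i)).symm

theorem ext_value
    (he : ∀ c, HasSum (fun n => c n • spaceAtom θ hφ n) (e c))
    (hC : ∀ t, sumC θ φ t < ∞) {f g : chirpSpace θ hφ}
    (h : ∀ t, value θ hφ f t = value θ hφ g t) : f = g := by
  refine Subtype.ext (Lp.ext ?_)
  filter_upwards [value_ae_eq he hC f, value_ae_eq he hC g] with t h1 h2
  rw [h1, h2, h]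

end Value

/-! ### The Zak transform and its symbol -/

section Zak

variable (θ : ℝ) {φ : ℝ → ℂ} {σ : ℝ}

theorem continuous_kernel (n : ℝ) : Continuous (kernel θ n) := by
  unfold kernel; fun_prop

theorem continuous_zakTerm (t : ℝ) (n : ℤ) : Continuous (zakTerm θ φ t n) := by
  unfold zakTerm
  exact continuous_const.mul (Complex.continuous_conj.comp (continuous_kernel θ n))

variable {θ} in
theorem IsZak.ae_eq {t : ℝ} {Z W : ℝ → ℂ} (hZ : IsZak θ φ t Z) (hW : IsZak θ φ t W) :
    Z =ᵐ[volume] W := by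
  -- Two local L² limits of the same series agree on each [-N, N], and these intervals exhaust the
  -- line.
  have h1 : ∀ N : ℕ, Z =ᵐ[volume.restrict (Set.Icc (-N : ℝ) N)] W := fun N => by
    have hzero : eLpNorm (Z - W) 2 (volume.restrict (Set.Icc (-N : ℝ) N)) = 0 := by
      have h2 := (hW.2 (-N) N).add (hZ.2 (-N) N)
      rw [add_zero] at h2
      refine le_antisymm (ge_of_tendsto' h2 fun s => ?_) zero_le
      have hm : Continuous fun ξ => ∑ n ∈ s, zakTerm θ φ t n ξ :=
        continuous_finsetSum _ fun n _ => continuous_zakTerm θ t n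
      have h3 : Z - W = (fun ξ => (∑ n ∈ s, zakTerm θ φ t n ξ) - W ξ) -
          fun ξ => (∑ n ∈ s, zakTerm θ φ t n ξ) - Z ξ := by
        ext ξ
        simp
      rw [h3]
      exact eLpNorm_sub_le (hm.aestronglyMeasurable.sub hW.1.restrict)
        (hm.aestronglyMeasurable.sub hZ.1.restrict) (by norm_num)
    rw [eLpNorm_eq_zero_iff (hZ.1.restrict.sub hW.1.restrict) (by norm_num)] at hzero
    exact hzero.mono fun ξ hξ => sub_eq_zero.1 hξ
  have h4 := (ae_restrict_iUnion_iff (μ := (volume : Measure ℝ))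
    (fun N : ℕ => Set.Icc (-N : ℝ) N) (fun ξ => Z ξ = W ξ)).2 h1
  have h5 : ⋃ N : ℕ, Set.Icc (-N : ℝ) N = Set.univ := by
    refine Set.eq_univ_of_forall fun ξ => ?_
    obtain ⟨N, hN⟩ := exists_nat_ge |ξ|
    exact Set.mem_iUnion.2 ⟨N, abs_le.1 hN⟩
  rwa [h5, Measure.restrict_univ] at h4

theorem exists_lp_samples (hσ : sumC θ φ σ < ∞) :
    ∃ g : lp (fun _ : ℤ => ℂ) 2, ∀ n : ℤ, g n = modulate θ φ (σ + n) := by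
  obtain ⟨k, hk, -⟩ := exists_lp_of_sumC_lt_top hσ
  refine ⟨⟨fun n => modulate θ φ (σ + n), memℓp_gen ?_⟩, fun n => rfl⟩
  have h := (Equiv.neg ℤ).summable_iff.2 (hasSum_norm_sq_lp k).summable
  refine Summable.congr h fun n => ?_
  simp [hk]

variable [Fact (Real.sin θ ≠ 0)]

/-- The chirp λ_θ(n) cancels the quadratic phase of the conjugate kernel in n; index -n matches the
sample at σ + n. -/
theorem zakTerm_eq (n : ℤ) (ξ : ℝ) : zakTerm θ φ σ (-n) ξ = conj (coefC θ * chirp θ ξ) *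
    (modulate θ φ (σ + n) * fourier (signEquiv θ n) (ξ : AddCircle (period θ))) := by
  rw [fourier_signEquiv_coe, zakTerm, kernel, chirp, chirp]
  simp only [map_mul, ← Complex.exp_conj, Complex.conj_ofReal, Complex.conj_I]
  have h : Complex.exp (((coefA θ * ((-n : ℤ) : ℝ) ^ 2 : ℝ) : ℂ) * Complex.I) *
      Complex.exp (((coefA θ * (((-n : ℤ) : ℝ) ^ 2 + ξ ^ 2) - coefB θ * ((-n : ℤ) : ℝ) * ξ : ℝ) : ℂ)
        * -Complex.I) =
      Complex.exp (((coefA θ * ξ ^ 2 : ℝ) : ℂ) * -Complex.I) *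
        Complex.exp (((-(coefB θ * n * ξ) : ℝ) : ℂ) * Complex.I) := by
    rw [← Complex.exp_add, ← Complex.exp_add]
    congr 1
    push_cast
    ring
  have h' : σ - ((-n : ℤ) : ℝ) = σ + n := by push_cast; ring
  rw [h']
  linear_combination (modulate θ φ (σ + n) * conj (coefC θ)) * h

theorem tendsto_enorm_sum_map_neg_sub {H : Type*} [NormedAddCommGroup H] {u : ℤ → H} {f : H}
    (h : HasSum u f) :
    Tendsto (fun s : Finset ℤ => ‖(∑ n ∈ s.map (Equiv.neg ℤ).toEmbedding, u n) - f‖ₑ) atTop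
      (𝓝 0) := by
  have h1 : HasSum (fun n => u (-n)) f := (Equiv.neg ℤ).hasSum_iff.2 h
  have h2 : Tendsto (fun s : Finset ℤ => (∑ n ∈ s, u (-n)) - f) atTop (𝓝 0) := by
    simpa using Tendsto.sub_const h1 f
  rw [← tendsto_zero_iff_enorm_tendsto_zero]
  refine h2.congr fun s => ?_
  rw [Finset.sum_map]
  rfl

/-- The symbol `∑ (λ_θ φ)(σ + n) exp(-ibnξ)` represents the Zak transform. -/
theorem isZak_symbol {g : lp (fun _ : ℤ => ℂ) 2}
    (hg : ∀ n : ℤ, g n = modulate θ φ (σ + n)) :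
    IsZak θ φ σ fun ξ => conj (coefC θ * chirp θ ξ) *
      (expBasis θ).repr.symm g (ξ : AddCircle (period θ)) := by
  set f := (expBasis θ).repr.symm g
  have hcont : Continuous fun ξ => conj (coefC θ * chirp θ ξ) :=
    Complex.continuous_conj.comp (continuous_const.mul (continuous_chirp θ))
  refine ⟨hcont.aestronglyMeasurable.mul ((Lp.stronglyMeasurable f).comp_measurable
    AddCircle.measurable_mk').aestronglyMeasurable, fun x y => ?_⟩
  obtain ⟨C, hC, hCle⟩ := exists_setLIntegral_Icc_coe_le (T := period θ) x y
  let r : Finset ℤ → ℝ≥0∞ := fun s =>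
    ‖(∑ n ∈ s.map (Equiv.neg ℤ).toEmbedding, g n • expBasis θ n) - f‖ₑ
  have hr : Tendsto r atTop (𝓝 0) :=
    tendsto_enorm_sum_map_neg_sub ((expBasis θ).hasSum_repr_symm g)
  -- The prefactor has modulus |c(θ)|, so the error on [x, y] is that of a periodic function,
  -- controlled by its L² norm on the circle.
  have hle : ∀ s : Finset ℤ, eLpNorm (fun ξ => (∑ n ∈ s, zakTerm θ φ σ n ξ) -
      conj (coefC θ * chirp θ ξ) * f (ξ : AddCircle (period θ))) 2
        (volume.restrict (Set.Icc x y)) ^ 2 ≤ ‖coefC θ‖ₑ ^ 2 * (C * r s ^ 2) := fun s => by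
    have h1 := eLpNorm_nnreal_pow_eq_lintegral (μ := volume.restrict (Set.Icc x y))
      (f := fun ξ => (∑ n ∈ s, zakTerm θ φ σ n ξ) -
      conj (coefC θ * chirp θ ξ) * f (ξ : AddCircle (period θ))) (p := 2) two_ne_zero
    simp only [NNReal.coe_ofNat, ENNReal.rpow_ofNat, ENNReal.coe_ofNat] at h1
    rw [h1]
    let F : AddCircle (period θ) → ℂ := fun z =>
      (∑ n ∈ s.map (Equiv.neg ℤ).toEmbedding, g n * fourier (signEquiv θ n) z) - f z
    have h2 : ∀ ξ : ℝ, ‖(∑ n ∈ s, zakTerm θ φ σ n ξ) -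
        conj (coefC θ * chirp θ ξ) * f (ξ : AddCircle (period θ))‖ₑ ^ 2 =
        ‖coefC θ‖ₑ ^ 2 * ‖F ξ‖ₑ ^ 2 := fun ξ => by
      have h3 : ∑ n ∈ s, zakTerm θ φ σ n ξ = conj (coefC θ * chirp θ ξ) *
          ∑ n ∈ s.map (Equiv.neg ℤ).toEmbedding,
            g n * fourier (signEquiv θ n) (ξ : AddCircle (period θ)) := by
        rw [Finset.mul_sum, Finset.sum_map]
        refine Finset.sum_congr rfl fun n _ => ?_
        have := zakTerm_eq θ (φ := φ) (σ := σ) (-n) ξ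
        rw [neg_neg] at this
        rw [this, hg]
        rfl
      have h4 : ‖conj (coefC θ * chirp θ ξ)‖ₑ = ‖coefC θ‖ₑ := by
        rw [← ofReal_norm, RCLike.norm_conj, norm_mul, norm_chirp, mul_one, ofReal_norm]
      rw [h3, ← mul_sub, enorm_mul, h4, mul_pow]
    rw [lintegral_congr h2, lintegral_const_mul' _ _ (by finiteness)]
    gcongr
    refine (hCle fun z => ‖F z‖ₑ ^ 2).trans_eq ?_
    congr 1
    simp only [r]
    rw [enorm_sq_eq_lintegral]
    refine lintegral_congr_ae ?_
    filter_upwards [coeFn_sum_smul (s.map (Equiv.neg ℤ).toEmbedding) g (coeFn_expBasis θ),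
      Lp.coeFn_sub (∑ n ∈ s.map (Equiv.neg ℤ).toEmbedding, g n • expBasis θ n) f] with z h5 h6
    rw [h6, Pi.sub_apply, h5]
  have hsq : Tendsto (fun s : Finset ℤ => eLpNorm (fun ξ => (∑ n ∈ s, zakTerm θ φ σ n ξ) -
      conj (coefC θ * chirp θ ξ) * f (ξ : AddCircle (period θ))) 2
        (volume.restrict (Set.Icc x y)) ^ 2) atTop (𝓝 0) := by
    refine tendsto_of_tendsto_of_tendsto_of_le_of_le tendsto_const_nhds ?_ (fun s => zero_le) hle
    have h1 : Tendsto (fun s => r s ^ 2) atTop (𝓝 0) := by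
      simpa using ENNReal.Tendsto.pow (n := 2) hr
    have h2 := ENNReal.Tendsto.const_mul (a := C) h1 (Or.inr hC)
    rw [mul_zero] at h2
    have h3 := ENNReal.Tendsto.const_mul (a := ‖coefC θ‖ₑ ^ 2) h2 (Or.inr (by finiteness))
    rwa [mul_zero] at h3
  have hroot := (ENNReal.continuous_rpow_const (y := 1 / 2)).continuousAt.tendsto.comp hsq
  rw [ENNReal.zero_rpow_of_pos (by norm_num)] at hroot
  refine hroot.congr fun s => ?_
  simp only [Function.comp_apply]
  rw [← ENNReal.rpow_natCast, ← ENNReal.rpow_mul]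
  norm_num

theorem norm_zak_ae {g : lp (fun _ : ℤ => ℂ) 2} (hg : ∀ n : ℤ, g n = modulate θ φ (σ + n)) :
    ∀ᵐ ξ : ℝ, ‖zak θ φ σ ξ‖ =
      ‖coefC θ‖ * ‖(expBasis θ).repr.symm g (ξ : AddCircle (period θ))‖ := by
  have h := isZak_symbol θ hg
  have hex : ∃ Z, IsZak θ φ σ Z := ⟨_, h⟩
  rw [zak, dif_pos hex]
  filter_upwards [hex.choose_spec.ae_eq h] with ξ hξ
  rw [hξ, norm_mul, RCLike.norm_conj, norm_mul, norm_chirp, mul_one]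

theorem zak_bounds_iff {g : lp (fun _ : ℤ => ℂ) 2} (hg : ∀ n : ℤ, g n = modulate θ φ (σ + n))
    {E : Set ℝ} (hE : E.OrdConnected) (hvol : volume E = ENNReal.ofReal (period θ)) :
    (∃ α β : ℝ, 0 < α ∧ α ≤ β ∧ ∀ᵐ ξ ∂(volume.restrict E),
      α ≤ ‖zak θ φ σ ξ‖ ∧ ‖zak θ φ σ ξ‖ ≤ β) ↔
    ∃ α β : ℝ, 0 < α ∧ α ≤ β ∧ ∀ᵐ x ∂(haarAddCircle (T := period θ)),
      α ≤ ‖(expBasis θ).repr.symm g x‖ ∧ ‖(expBasis θ).repr.symm g x‖ ≤ β := by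
  have hc : 0 < ‖coefC θ‖ := norm_pos_iff.2 (coefC_ne_zero θ)
  have hz := ae_restrict_of_ae (s := E) (norm_zak_ae θ hg)
  have hm := (Lp.stronglyMeasurable ((expBasis θ).repr.symm g)).norm.measurable
  have key := fun α β : ℝ => ae_restrict_coe_iff (T := period θ) hE hvol
    (p := fun x => α ≤ ‖(expBasis θ).repr.symm g x‖ ∧ ‖(expBasis θ).repr.symm g x‖ ≤ β)
    ((measurableSet_le measurable_const hm).inter (measurableSet_le hm measurable_const))
  constructor
  · rintro ⟨α, β, hα, hαβ, h⟩
    refine ⟨α / ‖coefC θ‖, β / ‖coefC θ‖, by positivity, by gcongr, (key _ _).1 ?_⟩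
    filter_upwards [h, hz] with ξ h1 h2
    rw [div_le_iff₀' hc, le_div_iff₀' hc, ← h2]
    exact h1
  · rintro ⟨α, β, hα, hαβ, h⟩
    refine ⟨‖coefC θ‖ * α, ‖coefC θ‖ * β, by positivity, by gcongr, ?_⟩
    filter_upwards [(key _ _).2 h, hz] with ξ h1 h2
    rw [h2]
    exact ⟨mul_le_mul_of_nonneg_left h1.1 hc.le, mul_le_mul_of_nonneg_left h1.2 hc.le⟩

end Zak

/-! ### Samples as Fourier coefficients of a product -/

section Samples

variable (θ : ℝ) {φ : ℝ → ℂ} {σ : ℝ}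

theorem signEquiv_sub (m n : ℤ) : signEquiv θ (m - n) = signEquiv θ m - signEquiv θ n := by
  rw [signEquiv]
  split_ifs
  · simp only [Equiv.neg_apply]; ring
  · rfl

variable [Fact (Real.sin θ ≠ 0)]

/-- The coefficients of a product are given by convolution. -/
theorem repr_of_ae_eq_mul {f F G : Lp ℂ 2 (haarAddCircle (T := period θ))}
    (hG : G =ᵐ[haarAddCircle] fun x => f x * F x) (m : ℤ) :
    HasSum (fun n => (expBasis θ).repr F n * (expBasis θ).repr f (m - n))
      ((expBasis θ).repr G m) := by
  have hX : MemLp (fun x => conj (f x) * fourier (signEquiv θ m) x) 2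
      (haarAddCircle (T := period θ)) := by
    refine (Lp.memLp f).of_le ((Complex.continuous_conj.comp_aestronglyMeasurable
      (Lp.aestronglyMeasurable f)).mul
        (fourier (signEquiv θ m)).continuous.aestronglyMeasurable) ?_
    exact Eventually.of_forall fun x => by
      rw [norm_mul, RCLike.norm_conj, fourier_apply, Circle.norm_coe, mul_one]
  -- No bound on f is available, so f is moved to the other side: the m-th coefficient of fF is
  -- ⟨conj(f)·e_m, F⟩, a pairing of two L² functions to which Parseval applies.
  have h1 := (expBasis θ).hasSum_inner_mul_inner (hX.toLp _) F
  have h2 : inner ℂ (hX.toLp _) F = (expBasis θ).repr G m := by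
    rw [HilbertBasis.repr_apply_apply, L2.inner_def, L2.inner_def]
    refine integral_congr_ae ?_
    filter_upwards [hX.coeFn_toLp, hG, coeFn_expBasis θ m] with x h3 h4 h5
    rw [h3, h4, h5]
    simp only [RCLike.inner_apply, map_mul, Complex.conj_conj]
    ring
  rw [h2] at h1
  refine h1.congr_fun fun n => ?_
  rw [(expBasis θ).repr_apply_apply F n, mul_comm]
  congr 1
  rw [HilbertBasis.repr_apply_apply, L2.inner_def, L2.inner_def]
  refine integral_congr_ae ?_
  filter_upwards [hX.coeFn_toLp, coeFn_expBasis θ n, coeFn_expBasis θ (m - n)] with x h3 h4 h5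
  rw [h3, h4, h5, signEquiv_sub, sub_eq_add_neg, _root_.fourier_add, _root_.fourier_neg]
  simp only [RCLike.inner_apply, map_mul, Complex.conj_conj]
  ring

theorem value_samples {hφ : MemLp φ 2 volume}
    {e : lp (fun _ : ℤ => ℂ) 2 ≃L[ℂ] chirpSpace θ hφ}
    (he : ∀ c, HasSum (fun n => c n • spaceAtom θ hφ n) (e c))
    {g : lp (fun _ : ℤ => ℂ) 2} (hg : ∀ n : ℤ, g n = modulate θ φ (σ + n))
    {F G : Lp ℂ 2 (haarAddCircle (T := period θ))}
    (hG : G =ᵐ[haarAddCircle] fun x => (expBasis θ).repr.symm g x * F x) (m : ℤ) :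
    value θ hφ (e ((expBasis θ).repr F)) (σ + m) =
      eta θ (σ + m) * (expBasis θ).repr G m := by
  rw [value_eq_tsum he, e.symm_apply_apply, ← (repr_of_ae_eq_mul θ hG m).tsum_eq]
  congr 1
  refine tsum_congr fun n => ?_
  rw [LinearIsometryEquiv.apply_symm_apply, hg]
  congr 2
  push_cast
  ring

end Samples

/-! ### Sampling expansions and bounds on the symbol -/

section Sampling

variable {θ : ℝ} {φ : ℝ → ℂ} {hφ : MemLp φ 2 volume} {σ : ℝ}

theorem ExpandsStrongly.expandsPointwise (hC : ∀ t, sumC θ φ t < ∞)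
    {S : ℤ → chirpSpace θ hφ} (hS : ExpandsStrongly θ hφ σ S) : ExpandsPointwise θ hφ σ S := by
  intro f t
  have h := (hS f).2 {t} ⟨(sumC θ φ t).toNNReal, fun s hs => by
    rw [Set.mem_singleton_iff.1 hs, ENNReal.coe_toNNReal (hC t).ne]⟩
  exact h.tendsto_at (Set.mem_singleton t)

/-- Evaluation is linear and bounded uniformly where C_{φ,θ} is bounded, so it can be applied to the
L² remainder. -/
theorem expandsStrongly_of_hasSum {e : lp (fun _ : ℤ => ℂ) 2 ≃L[ℂ] chirpSpace θ hφ}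
    (he : ∀ c, HasSum (fun n => c n • spaceAtom θ hφ n) (e c)) {S : ℤ → chirpSpace θ hφ}
    (hS : ∀ f, HasSum (fun n : ℤ => value θ hφ f (σ + n) • S n) f) :
    ExpandsStrongly θ hφ σ S := by
  refine fun f => ⟨hS f, fun X ⟨M, hM⟩ => ?_⟩
  rw [Metric.tendstoUniformlyOn_iff]
  intro ε hε
  have h1 : Tendsto (fun s : Finset ℤ =>
      ‖coefC θ‖ * (√M * ‖e.symm (f - ∑ n ∈ s, value θ hφ f (σ + n) • S n)‖)) atTop (𝓝 0) := by
    have h2 : Tendsto (fun s : Finset ℤ => f - ∑ n ∈ s, value θ hφ f (σ + n) • S n) atTop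
        (𝓝 0) := by
      simpa using Tendsto.const_sub f (hS f)
    have h3 := (e.symm.continuous.tendsto 0).comp h2
    have h4 := (h3.norm.const_mul √M).const_mul ‖coefC θ‖
    simpa using h4
  filter_upwards [h1.eventually (gt_mem_nhds hε)] with s hs t ht
  obtain ⟨L, hL⟩ := exists_value_clm he ((hM t ht).trans_lt ENNReal.coe_lt_top)
  have h5 : value θ hφ f t - ∑ n ∈ s, value θ hφ f (σ + n) * value θ hφ (S n) t =
      value θ hφ (f - ∑ n ∈ s, value θ hφ f (σ + n) • S n) t := by
    rw [← hL (f - _), map_sub, map_sum, hL]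
    congr 1
    refine Finset.sum_congr rfl fun n _ => ?_
    rw [map_smul, hL, smul_eq_mul]
  rw [dist_eq_norm, h5]
  exact (norm_value_le he (hM t ht) _).trans_lt hs

variable [Fact (Real.sin θ ≠ 0)]

/-- If the symbol is bounded above and away from zero, then there is a sampling Riesz basis. -/
theorem exists_isRieszBasis_expandsStrongly
    {e : lp (fun _ : ℤ => ℂ) 2 ≃L[ℂ] chirpSpace θ hφ}
    (he : ∀ c, HasSum (fun n => c n • spaceAtom θ hφ n) (e c))
    {g : lp (fun _ : ℤ => ℂ) 2} (hg : ∀ n : ℤ, g n = modulate θ φ (σ + n)) {α β : ℝ} (hα : 0 < α)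
    (hb : ∀ᵐ x ∂(haarAddCircle (T := period θ)),
      α ≤ ‖(expBasis θ).repr.symm g x‖ ∧ ‖(expBasis θ).repr.symm g x‖ ≤ β) :
    ∃ S : ℤ → chirpSpace θ hφ, IsRieszBasis S ∧ ExpandsStrongly θ hφ σ S := by
  obtain ⟨M, hM⟩ := exists_mul_equiv (Lp.aestronglyMeasurable _) hα hb
  obtain ⟨D, hD⟩ := exists_lp_diagonal_equiv (u := fun m : ℤ => eta θ (σ + m))
    (norm_pos_iff.2 (coefC_ne_zero θ)) (fun m => norm_eta θ _)
  let r := (expBasis θ).repr.toContinuousLinearEquiv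
  -- The inverse of the sampling map: remove the factors η_θ(σ+m), pass to the circle, divide by the
  -- symbol, take coefficients and synthesize.
  let e' : lp (fun _ : ℤ => ℂ) 2 ≃L[ℂ] chirpSpace θ hφ :=
    D.symm.trans (r.symm.trans (M.symm.trans (r.trans e)))
  have hval : ∀ c (m : ℤ), value θ hφ (e' c) (σ + m) = c m := fun c m => by
    have h1 := value_samples θ he hg (F := M.symm (r.symm (D.symm c))) (G := r.symm (D.symm c))
      (by simpa using hM (M.symm (r.symm (D.symm c)))) m
    have h2 : (expBasis θ).repr (r.symm (D.symm c)) = D.symm c := r.apply_symm_apply _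
    rw [h2, ← hD, D.apply_symm_apply] at h1
    exact h1
  have he' : ∀ c, HasSum (fun n => c n • e' (lp.single 2 n 1)) (e' c) := fun c => by
    refine ((hasSum_smul_single c).mapL (e' : _ →L[ℂ] chirpSpace θ hφ)).congr_fun fun n => ?_
    rw [map_smul]
    rfl
  refine ⟨fun n => e' (lp.single 2 n 1), .of_equiv e' he', expandsStrongly_of_hasSum he fun f => ?_⟩
  have h3 := he' (e'.symm f)
  rw [e'.apply_symm_apply] at h3
  refine h3.congr_fun fun n => ?_
  rw [← hval, e'.apply_symm_apply]

/-- A sampling frame forces the symbol to be bounded above and away from zero. -/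
theorem exists_symbol_bounds (hC : ∀ t, sumC θ φ t < ∞)
    {e : lp (fun _ : ℤ => ℂ) 2 ≃L[ℂ] chirpSpace θ hφ}
    (he : ∀ c, HasSum (fun n => c n • spaceAtom θ hφ n) (e c))
    {g : lp (fun _ : ℤ => ℂ) 2} (hg : ∀ n : ℤ, g n = modulate θ φ (σ + n))
    {S : ℤ → chirpSpace θ hφ} (hS : IsFrame S) (hexp : ExpandsPointwise θ hφ σ S) :
    ∃ α β : ℝ, 0 < α ∧ α ≤ β ∧ ∀ᵐ x ∂(haarAddCircle (T := period θ)),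
      α ≤ ‖(expBasis θ).repr.symm g x‖ ∧ ‖(expBasis θ).repr.symm g x‖ ≤ β := by
  obtain ⟨L, a, ha, hlow, hL⟩ := hS.exists_analysis
  obtain ⟨D, hD⟩ := exists_lp_diagonal_equiv (u := fun m : ℤ => eta θ (σ + m))
    (norm_pos_iff.2 (coefC_ne_zero θ)) (fun m => norm_eta θ _)
  let r := (expBasis θ).repr.toContinuousLinearEquiv
  let P := r.trans D
  let Q := (r.trans e).symm
  obtain ⟨p, hp, hplow⟩ := exists_adjoint_lower_bound P
  obtain ⟨q, hq, hqlow⟩ := exists_adjoint_lower_bound Q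
  let Pc : Lp ℂ 2 (haarAddCircle (T := period θ)) →L[ℂ] lp (fun _ : ℤ => ℂ) 2 := P
  let Qc : chirpSpace θ hφ →L[ℂ] Lp ℂ 2 (haarAddCircle (T := period θ)) := Q
  -- `P` sends ΦF to the samples of f, the adjoint of L reconstructs f by frame synthesis, and `Q`
  -- returns F.
  refine exists_bounds_of_left_inverse (Lp.aestronglyMeasurable _) (Qc ∘L L.adjoint ∘L Pc)
    (fun F G hFG => ?_) (c := p * a * q) (by positivity) fun F => ?_
  · change Q (L.adjoint (P G)) = F
    -- Only a pointwise expansion is assumed; the elements are compared through all their values,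
    -- where continuity of evaluation carries the synthesis series to the same numerical series.
    have h1 : L.adjoint (P G) = e (r F) := by
      refine ext_value he hC fun t => ?_
      obtain ⟨ev, hev⟩ := exists_value_clm he (hC t)
      have h2 := (hL (P G)).mapL ev
      rw [← hev, ← hev]
      refine h2.unique ?_
      rw [hev]
      refine (hexp (e (r F)) t).congr_fun fun n => ?_
      have h3 : value θ hφ (e (r F)) (σ + n) = P G n :=
        (value_samples θ he hg hFG n).trans (hD _ n).symm
      rw [h3, map_smul, hev, smul_eq_mul]
    rw [h1]
    exact (r.trans e).symm_apply_apply F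
  -- The adjoint is P* L Q*, a product of three operators bounded below by p, a and q.
  · rw [ContinuousLinearMap.adjoint_comp, ContinuousLinearMap.adjoint_comp,
      ContinuousLinearMap.adjoint_adjoint]
    have h1 : q * ‖F‖ ≤ ‖Qc.adjoint F‖ := hqlow F
    have h2 := hlow (Qc.adjoint F)
    have h3 : p * ‖L (Qc.adjoint F)‖ ≤ ‖Pc.adjoint (L (Qc.adjoint F))‖ := hplow _
    calc p * a * q * ‖F‖ = p * (a * (q * ‖F‖)) := by ring
      _ ≤ p * (a * ‖Qc.adjoint F‖) := by gcongr
      _ ≤ p * ‖L (Qc.adjoint F)‖ := by gcongr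
      _ ≤ _ := h3

end Sampling

end FracSampling

end

theorem mainTheorem3 (θ : ℝ) (hθ : Real.sin θ ≠ 0)
    (φ : ℝ → ℂ) (hφ : MemLp φ 2 volume)
    (hG : ∃ A B : ℝ, 0 < A ∧ A ≤ B ∧
      ∀ᵐ ξ ∂(volume.restrict (Set.Icc 0 (FracSampling.period θ))),
        ENNReal.ofReal A ≤ FracSampling.sumG θ hφ ξ ∧
        FracSampling.sumG θ hφ ξ ≤ ENNReal.ofReal B)
    (hC : ∀ t : ℝ, FracSampling.sumC θ φ t < ∞)
    (σ : ℝ) (hσ0 : 0 ≤ σ) (hσ1 : σ < 1)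
    (E : Set ℝ) (hE : E.OrdConnected)
    (hEvol : volume E = ENNReal.ofReal (FracSampling.period θ)) :
    List.TFAE [
      (∃ S : ℤ → FracSampling.chirpSpace θ hφ,
        FracSampling.IsFrame S ∧ FracSampling.ExpandsPointwise θ hφ σ S),
      (∃ S : ℤ → FracSampling.chirpSpace θ hφ,
        FracSampling.IsFrame S ∧ FracSampling.ExpandsStrongly θ hφ σ S),
      (∃ S : ℤ → FracSampling.chirpSpace θ hφ,
        FracSampling.IsRieszBasis S ∧ FracSampling.ExpandsPointwise θ hφ σ S),
      (∃ S : ℤ → FracSampling.chirpSpace θ hφ,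
        FracSampling.IsRieszBasis S ∧ FracSampling.ExpandsStrongly θ hφ σ S),
      (∃ α β : ℝ, 0 < α ∧ α ≤ β ∧
        ∀ᵐ ξ ∂(volume.restrict (Set.Icc 0 (FracSampling.period θ))),
          α ≤ ‖FracSampling.zak θ φ σ ξ‖ ∧ ‖FracSampling.zak θ φ σ ξ‖ ≤ β),
      (∃ α β : ℝ, 0 < α ∧ α ≤ β ∧
        ∀ᵐ ξ ∂(volume.restrict E),
          α ≤ ‖FracSampling.zak θ φ σ ξ‖ ∧ ‖FracSampling.zak θ φ σ ξ‖ ≤ β)] := by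
  have : Fact (Real.sin θ ≠ 0) := ⟨hθ⟩
  obtain ⟨e, he⟩ := (FracSampling.isRieszBasis_spaceAtom θ hφ hG).exists_equiv
  obtain ⟨g, hg⟩ := FracSampling.exists_lp_samples θ (hC σ)
  have hIcc := FracSampling.zak_bounds_iff θ hg (E := Set.Icc 0 (FracSampling.period θ))
    Set.ordConnected_Icc (by simp)
  have hEiff := FracSampling.zak_bounds_iff θ hg hE hEvol
  tfae_have 4 → 3 := fun ⟨S, hS, hexp⟩ => ⟨S, hS, hexp.expandsPointwise hC⟩
  tfae_have 4 → 2 := fun ⟨S, hS, hexp⟩ => ⟨S, hS.isFrame, hexp⟩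
  tfae_have 3 → 1 := fun ⟨S, hS, hexp⟩ => ⟨S, hS.isFrame, hexp⟩
  tfae_have 2 → 1 := fun ⟨S, hS, hexp⟩ => ⟨S, hS, hexp.expandsPointwise hC⟩
  -- The weakest sampling property already bounds the symbol, and the bounds return the strongest
  -- one.
  tfae_have 1 → 5 := fun ⟨_, hS, hexp⟩ =>
    hIcc.2 (FracSampling.exists_symbol_bounds hC he hg hS hexp)
  tfae_have 5 ↔ 6 := hIcc.trans hEiff.symm
  tfae_have 5 → 4 := fun h => by
    obtain ⟨α, β, hα, -, hb⟩ := hIcc.1 h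
    exact FracSampling.exists_isRieszBasis_expandsStrongly he hg hα hb
  tfae_finish
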